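/- Let $\alpha\in(\tfrac13,\tfrac12)$ and $n\ge1$. Throughout, bounds $\lesssim$ and $O(\cdot)$ are uniform over $s,t$ (or $x,y$) in each compact subset of $\mathbb R$, $X_{s,t}:=X_t-X_s$, and repeated indices $i$ are summed. Let $\mathbf X=(X,\mathbb X)$ be an $\alpha$-Hölder rough path in $\mathbb R^n$, i.e. $X\colon\mathbb R\to\mathbb R^n$ and $\mathbb X\colon\mathbb R^2\to\mathbb R^{n\times n}$ satisfy $\mathbb X^{i,j}_{s,t}-\mathbb X^{i,j}_{s,u}-\mathbb X^{i,j}_{u,t}=X^i_{s,u}X^j_{u,t}$ for all $s,u,t$, $|X_{s,t}|\lesssim|t-s|^\alpha$ and $|\mathbb X_{s,t}|\lesssim|t-s|^{2\alpha}$. Let $(Y,Y')$, $Y\colon\mathbb R\to\mathbb R$, $Y'\colon\mathbb R\to\mathbb R^n$, be controlled by $X$: $Y_t=Y_s+Y'_i(s)X^i_{s,t}+O(|t-s|^{2\alpha})$ and $|Y'_t-Y'_s|\lesssim|t-s|^\alpha$. Let $T$ be the vector space with basis $\mathbf 1,\mathbb W_i,\Xi_j,\mathbb W_i\Xi_j$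 ($1\le i,j\le n$), of homogeneities $0,\alpha,\alpha-1,2\alpha-1$; let $T_\beta$ be the span of the basis vectors of homogeneity $\beta$ and $\|\tau\|_\beta$ the norm of the $T_\beta$-component of $\tau$. Define linear maps $\Gamma_{su}\colon T\to T$ by $\Gamma_{su}\mathbf 1=\mathbf 1$, $\Gamma_{su}\Xi_j=\Xi_j$, $\Gamma_{su}\mathbb W_i=\mathbb W_i-X^i_{s,u}\mathbf 1$, $\Gamma_{su}(\mathbb W_i\Xi_j)=\mathbb W_i\Xi_j-X^i_{s,u}\Xi_j$, and linear maps $\Pi_s$ from $T$ to the distributions on $\mathbb R$ by $(\Pi_s\mathbf 1)(t)=1$, $(\Pi_s\mathbb W_i)(t)=X^i_{s,t}$, $(\Pi_s\Xi_j)(\psi)=\int\psi(t)\,dX^j_t$, $(\Pi_s\mathbb W_i\Xi_j)(\psi)=\int\psi(t)\,d_t\mathbb X^{i,j}_{s,t}$ (Riemann–Stieltjes integrals, $\psi\in C_c^\infty(\mathbb R)$). Let $\mathcal D^\gamma$ be the set of $f\colon\mathbb R\to\bigoplus_{\beta<\gamma}T_\beta$ with $\|f(x)-\Gamma_{xy}f(y)\|_\beta\lesssim|x-y|^{\gamma-\beta}$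 for all $\beta<\gamma$. For $r>0$ let $\mathcal B_r$ be the set of smooth $\varphi$ supported in $[-1,1]$ with $\|\varphi\|_{C^r}\le1$, and $\varphi_x^\lambda(y)=\lambda^{-1}\varphi(\lambda^{-1}(y-x))$. A distribution $\eta$ is a reconstruction of $f\in\mathcal D^\gamma$ if $|(\eta-\Pi_xf(x))(\varphi_x^\lambda)|\lesssim\lambda^\gamma$ uniformly over $\varphi\in\mathcal B_r$, $\lambda\in(0,1]$ and locally uniformly in $x$. Fix $j$ and set $(\hat Y\Xi_j)(s)=Y(s)\,\Xi_j+Y'_i(s)\,\mathbb W_i\Xi_j$. Then $\hat Y\Xi_j\in\mathcal D^{3\alpha-1}$. Moreover $\hat Y\Xi_j$ has, for every $r>1-\alpha$, exactly one reconstruction $\mathcal R\hat Y\Xi_j$, which does not depend on $r$, and there is a function $Z\colon\mathbb R\to\mathbb R$ such that $$(\mathcal R\hat Y\Xi_j)(\psi)=\int\psi(t)\,dZ(t)\qquad\text{for every }\psi\in C_c^\infty(\mathbb R)$$ (Riemann–Stieltjes integral) and $$Z_t-Z_s=Y(s)\,X^j_{s,t}+Y'_i(s)\,\mathbb X^{i,j}_{s,t}+O(|t-s|^{3\alpha}).$$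 In particular $Z$ is the rough integral of $Y$ against $X^j$: for $s\le t$, the sums $\sum_k\bigl(Y(u_k)X^j_{u_k,u_{k+1}}+Y'_i(u_k)\mathbb X^{i,j}_{u_k,u_{k+1}}\bigr)$ over partitions $s=u_0\le\dots\le u_N=t$ converge to $Z_t-Z_s$ as the mesh tends to $0$. -/

import Mathlib

open Set MeasureTheory TopologicalSpace
open scoped Distributions LineDeriv

noncomputable section

namespace ControlledRP

/-! ### Test functions, distributions and Stieltjes integrals on the real line -/

/-- Smooth compactly supported test functions on `ℝ`. -/
abbrev TestFn : Type := 𝓓((⊤ : Opens ℝ), ℝ)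

/-- Schwartz distributions on `ℝ`. -/
abbrev Distr : Type := 𝓓'((⊤ : Opens ℝ), ℝ)

/-- The rescaled test function `φ_x^l(y) = l⁻¹ φ (l⁻¹ (y - x))`. -/
def rescale (φ : TestFn) (x l : ℝ) (hl : 0 < l) : TestFn where
  toFun y := l⁻¹ * φ (l⁻¹ * (y - x))
  contDiff' := by
    have h := φ.contDiff
    fun_prop
  hasCompactSupport' := by
    have hl' : l⁻¹ ≠ 0 := inv_ne_zero hl.ne'
    have h := φ.hasCompactSupport.comp_homeomorph
      ((Homeomorph.addRight (-x)).trans (Homeomorph.mulLeft₀ l⁻¹ hl'))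
    exact HasCompactSupport.mul_left (f := fun _ : ℝ => l⁻¹) h
  tsupport_subset' := fun _ _ => trivial

/-- The smooth elements of the set `B_r`: test functions supported in the closed unit ball whose
`C^r` norm is at most `1`, for real `r > 0`. The order `k` of the last clause is the one with
`k < r ≤ k + 1`; for integer `r` that clause says that the derivative of order `r` is bounded
by `1`. -/
structure InBall (r : ℝ) (φ : TestFn) : Prop where
  support : tsupport φ ⊆ Metric.closedBall (0 : ℝ) 1
  bound : ∀ k : ℕ, (k : ℝ) < r → ∀ t : ℝ, |iteratedDeriv k φ t| ≤ 1
  holder : ∀ k : ℕ, (k : ℝ) < r → r ≤ k + 1 → ∀ s t : ℝ,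
    |iteratedDeriv k φ t - iteratedDeriv k φ s| ≤ |t - s| ^ (r - k)

/-- The distribution `ψ ↦ ∫ ψ(t) g(t) dt` given by a locally integrable function `g`. -/
def ofFun (g : ℝ → ℝ) : Distr :=
  TestFunction.integralAgainstBilinCLM (ContinuousLinearMap.mul ℝ ℝ) volume g

/-- The distribution `ψ ↦ ∫ ψ(t) dg(t)`, that is, the distributional derivative of `g`.
For continuous `g` it is given by the Riemann-Stieltjes integral,
see `hasStieltjesIntegral_stieltjes`. -/
def stieltjes (g : ℝ → ℝ) : Distr := ∂_{(1 : ℝ)} (ofFun g)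

/-- `u 0 ≤ u 1 ≤ ⋯ ≤ u N` is a partition of `[a, b]` of mesh less than `δ`. -/
structure IsPartition (a b δ : ℝ) (N : ℕ) (u : ℕ → ℝ) : Prop where
  left : u 0 = a
  right : u N = b
  step : ∀ k < N, u k ≤ u (k + 1)
  mesh : ∀ k < N, u (k + 1) - u k < δ

/-- The compactly supported function `ψ` has Riemann-Stieltjes integral `I` against `g`: on every
interval that contains the support of `ψ`, the tagged Riemann sums converge to `I` as the mesh
tends to zero. -/
def HasStieltjesIntegral (ψ g : ℝ → ℝ) (I : ℝ) : Prop :=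
  ∀ a b : ℝ, a ≤ b → tsupport ψ ⊆ Icc a b → ∀ ε > 0, ∃ δ > 0, ∀ (N : ℕ) (u v : ℕ → ℝ),
    IsPartition a b δ N u → (∀ k < N, v k ∈ Icc (u k) (u (k + 1))) →
      |∑ k ∈ Finset.range N, ψ (v k) * (g (u (k + 1)) - g (u k)) - I| < ε

theorem stieltjes_apply {g : ℝ → ℝ} (hg : Continuous g) (ψ : TestFn) :
    stieltjes g ψ = -∫ t, deriv ψ t * g t := by
  have hloc : LocallyIntegrableOn g ((⊤ : Opens ℝ) : Set ℝ) volume :=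
    hg.locallyIntegrable.locallyIntegrableOn _
  have h1 : stieltjes g ψ = -(ofFun g (∂_{(1 : ℝ)} ψ)) := rfl
  have h2 : ofFun g (∂_{(1 : ℝ)} ψ) = ∫ t, (∂_{(1 : ℝ)} ψ) t * g t :=
    TestFunction.integralAgainstBilinCLM_eq_integral hloc
  have h3 : ∀ t, (∂_{(1 : ℝ)} ψ) t = deriv ψ t := by
    intro t
    rw [TestFunction.lineDerivOp_eq_lineDerivCLM ℝ,
      TestFunction.lineDerivCLM_apply_of_le (by simp)]
    have h := deriv_comp_const_add (f := ψ) (a := t) (x := (0 : ℝ))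
    simpa [lineDeriv] using h
  rw [h1, h2]
  simp only [h3]

theorem hasStieltjesIntegral_stieltjes {g : ℝ → ℝ} (hg : Continuous g) (ψ : TestFn) :
    HasStieltjesIntegral ψ g (stieltjes g ψ) := by
  intro a b hab hsupp ε hε
  have hψd : ContDiff ℝ 1 ψ := ψ.contDiff.of_le (by exact_mod_cast le_top)
  have hψ' : Continuous (deriv ψ) := hψd.continuous_deriv le_rfl
  have hintc : ∀ c x y : ℝ, IntervalIntegrable (fun t => deriv ψ t * c) volume x y := fun c x y =>
    (hψ'.mul continuous_const).intervalIntegrable _ _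
  have hint0 : ∀ x y : ℝ, IntervalIntegrable (fun t => deriv ψ t * g t) volume x y := fun x y =>
    (hψ'.mul hg).intervalIntegrable _ _
  have hftc : ∀ x y : ℝ, ∫ t in x..y, deriv ψ t = ψ y - ψ x := fun x y =>
    intervalIntegral.integral_deriv_eq_sub
      (fun t _ => (hψd.differentiable one_ne_zero) t) (hψ'.intervalIntegrable _ _)
  -- the function vanishes outside of the open interval
  have hout : ∀ x, x ∉ Ioo a b → ψ x = 0 := by
    have hcl : IsClosed {x | ψ x = 0} := isClosed_eq ψ.continuous continuous_const
    have hsub : (Icc a b)ᶜ ⊆ {x | ψ x = 0} := fun x hx =>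
      image_eq_zero_of_notMem_tsupport fun h => hx (hsupp h)
    have hsub2 : closure ((Icc a b)ᶜ) ⊆ {x | ψ x = 0} := closure_minimal hsub hcl
    intro x hx
    apply hsub2
    rw [closure_compl, interior_Icc]
    exact hx
  have ha : ψ a = 0 := hout a (by simp)
  have hb : ψ b = 0 := hout b (by simp)
  have hval : stieltjes g ψ = -∫ t in a..b, deriv ψ t * g t := by
    rw [stieltjes_apply hg, intervalIntegral.integral_of_le hab, ← integral_Icc_eq_integral_Ioc,
      setIntegral_eq_integral_of_forall_compl_eq_zero]
    intro x hx
    have : deriv ψ x = 0 := by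
      apply image_eq_zero_of_notMem_tsupport
      exact fun h => hx (hsupp (tsupport_deriv_subset h))
    simp [this]
  obtain ⟨M, hM⟩ := isCompact_Icc.exists_bound_of_continuousOn
    (s := Icc a b) hψ'.continuousOn
  have hM0 : 0 ≤ M := (norm_nonneg _).trans (hM a ⟨le_rfl, hab⟩)
  set ω : ℝ := ε / ((M + 1) * (b - a + 1)) with hω
  have hω0 : 0 < ω := by
    have : 0 < b - a + 1 := by linarith
    positivity
  have huc := isCompact_Icc.uniformContinuousOn_of_continuous (s := Icc a b) hg.continuousOn
  rw [Metric.uniformContinuousOn_iff] at huc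
  obtain ⟨δ, hδ, hgδ⟩ := huc ω hω0
  refine ⟨δ, hδ, fun N u v hu hv => ?_⟩
  have hmono : ∀ m ≤ N, ∀ k ≤ m, u k ≤ u m := by
    intro m
    induction m with
    | zero => intro _ k hk; simp [Nat.le_zero.mp hk]
    | succ m ih =>
      intro hm k hk
      rcases Nat.lt_or_ge k (m + 1) with h | h
      · exact (ih (by omega) k (by omega)).trans (hu.step m (by omega))
      · rw [le_antisymm hk h]
  have hmem : ∀ k ≤ N, u k ∈ Icc a b := fun k hk =>
    ⟨hu.left ▸ hmono k hk 0 (Nat.zero_le _), hu.right ▸ hmono N le_rfl k hk⟩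
  -- one cell
  have hcell : ∀ k ∈ Finset.range N,
      |ψ (v k) * (g (u (k + 1)) - g (u k)) + (∫ t in (u k)..(u (k + 1)), deriv ψ t * g t)
        - (ψ (u (k + 1)) * g (u (k + 1)) - ψ (u k) * g (u k))|
        ≤ M * ω * (u (k + 1) - u k) := by
    intro k hk
    have hkN : k < N := Finset.mem_range.mp hk
    obtain ⟨hv1, hv2⟩ := hv k hkN
    have hk0 := hmem k hkN.le
    have hk1 := hmem (k + 1) hkN
    have hme := hu.mesh k hkN
    have e1 : ∫ t in (u k)..(v k), deriv ψ t * (g t - g (u k))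
        = (∫ t in (u k)..(v k), deriv ψ t * g t) - (ψ (v k) - ψ (u k)) * g (u k) := by
      simp only [mul_sub]
      rw [intervalIntegral.integral_sub (hint0 _ _)
        (hintc _ _ _),
        intervalIntegral.integral_mul_const, hftc]
    have e2 : ∫ t in (v k)..(u (k + 1)), deriv ψ t * (g t - g (u (k + 1)))
        = (∫ t in (v k)..(u (k + 1)), deriv ψ t * g t)
          - (ψ (u (k + 1)) - ψ (v k)) * g (u (k + 1)) := by
      simp only [mul_sub]
      rw [intervalIntegral.integral_sub (hint0 _ _)
        (hintc _ _ _),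
        intervalIntegral.integral_mul_const, hftc]
    have e3 := intervalIntegral.integral_add_adjacent_intervals
      (hint0 (u k) (v k)) (hint0 (v k) (u (k + 1)))
    have b1 : ‖∫ t in (u k)..(v k), deriv ψ t * (g t - g (u k))‖ ≤ M * ω * |v k - u k| := by
      apply intervalIntegral.norm_integral_le_of_norm_le_const
      intro t ht
      rw [uIoc_of_le hv1] at ht
      have htm : t ∈ Icc a b := ⟨hk0.1.trans ht.1.le, (ht.2.trans hv2).trans hk1.2⟩
      rw [norm_mul]
      refine mul_le_mul (hM t htm) ?_ (norm_nonneg _) hM0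
      have := hgδ t htm (u k) hk0 (by
        rw [Real.dist_eq, abs_of_nonneg (by linarith [ht.1])]; linarith [ht.2])
      rw [Real.dist_eq] at this
      exact this.le
    have b2 : ‖∫ t in (v k)..(u (k + 1)), deriv ψ t * (g t - g (u (k + 1)))‖
        ≤ M * ω * |u (k + 1) - v k| := by
      apply intervalIntegral.norm_integral_le_of_norm_le_const
      intro t ht
      rw [uIoc_of_le hv2] at ht
      have htm : t ∈ Icc a b := ⟨(hk0.1.trans hv1).trans ht.1.le, ht.2.trans hk1.2⟩
      rw [norm_mul]
      refine mul_le_mul (hM t htm) ?_ (norm_nonneg _) hM0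
      have := hgδ t htm (u (k + 1)) hk1 (by
        rw [Real.dist_eq, abs_of_nonpos (by linarith [ht.2])]; linarith [ht.1])
      rw [Real.dist_eq] at this
      exact this.le
    rw [abs_of_nonneg (by linarith : (0 : ℝ) ≤ v k - u k), e1, Real.norm_eq_abs] at b1
    rw [abs_of_nonneg (by linarith : (0 : ℝ) ≤ u (k + 1) - v k), e2, Real.norm_eq_abs] at b2
    rw [← e3]
    have := abs_add_le
      ((∫ t in (u k)..(v k), deriv ψ t * g t) - (ψ (v k) - ψ (u k)) * g (u k))
      ((∫ t in (v k)..(u (k + 1)), deriv ψ t * g t) - (ψ (u (k + 1)) - ψ (v k)) * g (u (k + 1)))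
    refine le_trans (le_of_eq ?_) (this.trans ((add_le_add b1 b2).trans (le_of_eq (by ring))))
    congr 1
    ring
  have hI : ∑ k ∈ Finset.range N, ∫ t in (u k)..(u (k + 1)), deriv ψ t * g t
      = ∫ t in a..b, deriv ψ t * g t := by
    rw [intervalIntegral.sum_integral_adjacent_intervals fun k _ => hint0 _ _, hu.left, hu.right]
  have hT : ∑ k ∈ Finset.range N, (ψ (u (k + 1)) * g (u (k + 1)) - ψ (u k) * g (u k)) = 0 := by
    rw [Finset.sum_range_sub (fun k => ψ (u k) * g (u k)), hu.left, hu.right, ha, hb]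
    ring
  have hL : ∑ k ∈ Finset.range N, M * ω * (u (k + 1) - u k) = M * ω * (b - a) := by
    rw [← Finset.mul_sum, Finset.sum_range_sub, hu.left, hu.right]
  have hsum := (Finset.abs_sum_le_sum_abs _ _).trans (Finset.sum_le_sum hcell)
  rw [Finset.sum_sub_distrib, Finset.sum_add_distrib, hI, hT, hL] at hsum
  rw [hval, sub_neg_eq_add]
  rw [sub_zero] at hsum
  refine hsum.trans_lt ?_
  have h1 : ω * ((M + 1) * (b - a + 1)) = ε := by
    rw [hω]
    have : 0 < b - a + 1 := by linarith
    field_simp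
  nlinarith [mul_nonneg hM0 hω0.le, mul_nonneg hω0.le (sub_nonneg.mpr hab)]

/-! ### The regularity structure -/

/-- The unit vectors `𝟏`, `𝕎_i`, `Ξ_j` and `𝕎_i Ξ_j` of the model space. -/
inductive Symb (n : ℕ) : Type
  | one : Symb n
  | W (i : Fin n) : Symb n
  | Xi (j : Fin n) : Symb n
  | WXi (i j : Fin n) : Symb n
  deriving DecidableEq, Fintype

/-- The homogeneities; `A = {α - 1, 2α - 1, 0, α}`. -/
def Symb.deg {n : ℕ} (α : ℝ) : Symb n → ℝ
  | .one => 0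
  | .W _ => α
  | .Xi _ => α - 1
  | .WXi _ _ => 2 * α - 1

/-- The model space `T`, the span of the symbols; `T_β` is spanned by the symbols of
homogeneity `β`. -/
abbrev ModelSpace (n : ℕ) : Type := Symb n → ℝ

/-- The unit vector of `T` belonging to a symbol. -/
def vec {n : ℕ} (σ : Symb n) : ModelSpace n := Pi.single σ 1

open Classical in
/-- `‖τ‖_β`, the norm of the component of `τ` in the finite-dimensional space `T_β`. -/
def compNorm {n : ℕ} (α β : ℝ) (τ : ModelSpace n) : ℝ :=
  ∑ σ : Symb n with σ.deg α = β, |τ σ|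

/-- The values `Γ_x τ` on the unit vectors `τ` of `T`, for `x ∈ ℝⁿ`. -/
def groupActionSymb {n : ℕ} (x : Fin n → ℝ) : Symb n → ModelSpace n
  | .one => vec .one
  | .W i => vec (.W i) - x i • vec .one
  | .Xi j => vec (.Xi j)
  | .WXi i j => vec (.WXi i j) - x i • vec (.Xi j)

/-- The linear operator `Γ_x` on `T`; the structure group is `{Γ_x | x ∈ ℝⁿ}`. -/
def groupAction {n : ℕ} (x : Fin n → ℝ) : ModelSpace n →ₗ[ℝ] ModelSpace n :=
  Fintype.linearCombination ℝ (groupActionSymb x)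

/-! ### Rough paths and their models -/

/-- An `α`-Hölder rough path on `ℝ` with values in `ℝⁿ`, with Chen's relations and Hölder bounds
that hold uniformly on compact sets. -/
structure RoughPath (α : ℝ) (n : ℕ) where
  X : ℝ → Fin n → ℝ
  XX : ℝ → ℝ → Fin n → Fin n → ℝ
  chen : ∀ (s u t : ℝ) (i j : Fin n),
    XX s t i j - XX s u i j - XX u t i j = (X u i - X s i) * (X t j - X u j)
  holder : ∀ K : Set ℝ, IsCompact K → ∃ C : ℝ, ∀ s ∈ K, ∀ t ∈ K, ‖X t - X s‖ ≤ C * |t - s| ^ α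
  holder_two : ∀ K : Set ℝ, IsCompact K → ∃ C : ℝ, ∀ s ∈ K, ∀ t ∈ K,
    ‖XX s t‖ ≤ C * |t - s| ^ (2 * α)

namespace RoughPath

variable {α : ℝ} {n : ℕ} (R : RoughPath α n)

/-- `Γ_{su} = Γ_{X_{s,u}}`, where `X_{s,u} = X_u - X_s`. -/
def Gam (s u : ℝ) : ModelSpace n →ₗ[ℝ] ModelSpace n := groupAction (R.X u - R.X s)

/-- The distributions `Π_s τ` for the unit vectors `τ` of `T`. -/
def PiSymb (s : ℝ) : Symb n → Distr
  | .one => ofFun fun _ => 1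
  | .W i => ofFun fun t => R.X t i - R.X s i
  | .Xi j => stieltjes fun t => R.X t j
  | .WXi i j => stieltjes fun t => R.XX s t i j

/-- The linear map `Π_s` of the model given by the rough path. -/
def PiMap (s : ℝ) : ModelSpace n →ₗ[ℝ] Distr := Fintype.linearCombination ℝ (R.PiSymb s)

/-- The space `D^γ` of modelled distributions. -/
def modelled (γ : ℝ) : Set (ℝ → ModelSpace n) :=
  {f | (∀ (x : ℝ) (σ : Symb n), γ ≤ σ.deg α → f x σ = 0) ∧
    ∀ K : Set ℝ, IsCompact K → ∀ β < γ, ∃ C : ℝ, ∀ x ∈ K, ∀ y ∈ K,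
      compNorm α β (f x - R.Gam x y (f y)) ≤ C * |x - y| ^ (γ - β)}

/-- The distribution `η` satisfies the bound that characterizes the reconstruction of `f ∈ D^γ`:
`|(η - Π_x f(x))(φ_x^l)| ≲ l^γ`, uniformly over `φ ∈ B_r` and `l ∈ (0, 1]`, and locally uniformly
in `x`. -/
def IsReconstruction (r γ : ℝ) (f : ℝ → ModelSpace n) (η : Distr) : Prop :=
  ∀ K : Set ℝ, IsCompact K → ∃ C : ℝ, ∀ x ∈ K, ∀ φ : TestFn, InBall r φ →
    ∀ (l : ℝ) (hl : 0 < l), l ≤ 1 →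
      |(η - R.PiMap x (f x)) (rescale φ x l hl)| ≤ C * l ^ γ

/-- `(Y, Y')` is a path controlled by the rough path: `Y_t = Y_s + Y'_s X_{s,t} + O(|t - s|^{2α})`
with `Y'` of class `C^α`, uniformly on compact sets. -/
structure IsControlled (Y : ℝ → ℝ) (Y' : ℝ → Fin n → ℝ) : Prop where
  remainder : ∀ K : Set ℝ, IsCompact K → ∃ C : ℝ, ∀ s ∈ K, ∀ t ∈ K,
    |Y t - Y s - ∑ i, Y' s i * (R.X t i - R.X s i)| ≤ C * |t - s| ^ (2 * α)
  holder : ∀ K : Set ℝ, IsCompact K → ∃ C : ℝ, ∀ s ∈ K, ∀ t ∈ K,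
    ‖Y' t - Y' s‖ ≤ C * |t - s| ^ α

/-- The local expansion `Y(s) X^j_{s,t} + Y'_i(s) 𝕏^{i,j}_{s,t}`. -/
def germ (Y : ℝ → ℝ) (Y' : ℝ → Fin n → ℝ) (j : Fin n) (s t : ℝ) : ℝ :=
  Y s * (R.X t j - R.X s j) + ∑ i, Y' s i * R.XX s t i j

/-- `Z` is an indefinite rough integral of `Y` against `X^j`: its increments are the limits of the
compensated Riemann sums as the mesh tends to zero. -/
def IsRoughIntegral (Y : ℝ → ℝ) (Y' : ℝ → Fin n → ℝ) (j : Fin n) (Z : ℝ → ℝ) : Prop :=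
  ∀ s t : ℝ, s ≤ t → ∀ ε > 0, ∃ δ > 0, ∀ (N : ℕ) (u : ℕ → ℝ), IsPartition s t δ N u →
    |∑ k ∈ Finset.range N, R.germ Y Y' j (u k) (u (k + 1)) - (Z t - Z s)| < ε

end RoughPath

/-- The map `(Ŷ Ξ_j)(s) = Y(s) Ξ_j + Y'_i(s) 𝕎_i Ξ_j`. -/
def mulXi {n : ℕ} (Y : ℝ → ℝ) (Y' : ℝ → Fin n → ℝ) (j : Fin n) (s : ℝ) : ModelSpace n :=
  Y s • vec (.Xi j) + ∑ i, Y' s i • vec (.WXi i j)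

end ControlledRP

end

open ControlledRP

namespace ControlledRP

open Filter Topology
open scoped ContDiff

/-! ### Sewing -/

/-! Write `A s t` for the germ `Y(s) X^j_{s,t} + Y'_i(s) 𝕏^{i,j}_{s,t}`. Chen's relation and the
controlled expansion of `Y` give `A s t - A s u - A u t` of order `3α > 1`
(`germ_sub_germ_sub_germ`, `exists_germ_bound`). Sewing (`exists_primitive`) then yields `Z` whose
increments agree with `A` up to order `3α`, and such increments are limits of the compensated sums
(`exists_mesh_abs_sum_sub_lt`).

The reconstruction is `dZ`. Indeed `dZ - Π_x f(x) = dg` for a function `g` depending on `x`, and an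
increment of `g` is a sewing remainder minus a defect of the germ based at `x`. Near `x`, at scale
`l`, it is therefore of order `l^{2α} |t - s|^α`. Rescaled test functions are Hölder of order `ρ =
min r 1` with constant `l^{-1-ρ}`, and `ρ + α > 1`, so Young's bound (`abs_stieltjes_le`) gives
`l^{3α-1}`.

For uniqueness, the difference of two reconstructions is `O(l^γ)` on rescaled test functions, with
`γ = 3α - 1 > 0`. A fixed test function is a sum of about `1/l` such functions with weights of order
`l`, hence the difference vanishes on it (`eq_zero_of_abs_rescale_le`).

Membership in `D^{3α-1}` is the definition of a controlled path read off coefficient by coefficient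
(`mulXi_sub_Gam`). -/

theorem le_of_forall_step_le {u : ℕ → ℝ} {N : ℕ} (hu : ∀ k < N, u k ≤ u (k + 1)) {i j : ℕ}
    (hij : i ≤ j) (hj : j ≤ N) : u i ≤ u j := by
  induction j, hij using Nat.le_induction with
  | base => exact le_rfl
  | succ m hm ih => exact (ih (by omega)).trans (hu m (by omega))

theorem IsPartition.mem_Icc {a b δ : ℝ} {N : ℕ} {u : ℕ → ℝ} (h : IsPartition a b δ N u) {k : ℕ}
    (hk : k ≤ N) : u k ∈ Set.Icc a b :=
  ⟨h.left ▸ le_of_forall_step_le h.step (Nat.zero_le k) hk,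
    h.right ▸ le_of_forall_step_le h.step hk le_rfl⟩

/-- Selects the cell of a partition that contains the midpoint of the interval. -/
theorem exists_crossing {f : ℕ → ℝ} {c : ℝ} (h0 : f 0 ≤ c) :
    ∀ d : ℕ, 0 < d → c ≤ f d → ∃ k < d, f k ≤ c ∧ c ≤ f (k + 1) := by
  intro d
  induction d with
  | zero => intro h; omega
  | succ d ih =>
    intro _ hd
    by_cases hc : c ≤ f d
    · rcases Nat.eq_zero_or_pos d with rfl | hpos
      · exact ⟨0, by omega, h0, hd⟩
      · obtain ⟨k, hk, h⟩ := ih hpos hc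
        exact ⟨k, by omega, h⟩
    · exact ⟨d, by omega, (not_le.mp hc).le, hd⟩

/-- The constant of the sewing lemma. -/
noncomputable def sewConst (θ : ℝ) : ℝ := 2 / (1 - 2 ^ (1 - θ))

theorem two_rpow_one_sub_lt_one {θ : ℝ} (hθ : 1 < θ) : (2 : ℝ) ^ (1 - θ) < 1 :=
  Real.rpow_lt_one_of_one_lt_of_neg one_lt_two (by linarith)

theorem sewConst_pos {θ : ℝ} (hθ : 1 < θ) : 0 < sewConst θ :=
  div_pos two_pos (sub_pos.mpr (two_rpow_one_sub_lt_one hθ))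

/-- `A` is additive up to an error of order `θ` on the interval `[a, b]`. -/
def AlmostAdditive (A : ℝ → ℝ → ℝ) (θ C a b : ℝ) : Prop :=
  ∀ s ∈ Set.Icc a b, ∀ u ∈ Set.Icc a b, ∀ t ∈ Set.Icc a b,
    |A s t - A s u - A u t| ≤ C * (|u - s| + |t - u|) ^ θ

namespace AlmostAdditive

variable {A : ℝ → ℝ → ℝ} {θ C a b : ℝ}

theorem self_eq_zero (hA : AlmostAdditive A θ C a b) (hθ : 1 < θ) {s : ℝ}
    (hs : s ∈ Set.Icc a b) : A s s = 0 := by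
  have h := hA s hs s hs s hs
  rw [sub_self, sub_self, abs_zero, add_zero, Real.zero_rpow (by linarith), mul_zero] at h
  have := abs_nonpos_iff.mp h
  linarith

theorem le_of_le (hA : AlmostAdditive A θ C a b) {s u t : ℝ} (hs : a ≤ s) (hsu : s ≤ u)
    (hut : u ≤ t) (ht : t ≤ b) : |A s t - A s u - A u t| ≤ C * (t - s) ^ θ := by
  have h := hA s ⟨hs, by linarith⟩ u ⟨by linarith, by linarith⟩ t ⟨by linarith, ht⟩
  rwa [abs_of_nonneg (by linarith : 0 ≤ u - s), abs_of_nonneg (by linarith : 0 ≤ t - u),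
    sub_add_sub_cancel'] at h

/-- Sums of an almost additive function along any partition are close to its value on the whole
interval. -/
theorem abs_sum_sub_le (hA : AlmostAdditive A θ C a b) (hθ : 1 < θ) (hC : 0 ≤ C) :
    ∀ (d : ℕ) (u : ℕ → ℝ), (∀ k < d, u k ≤ u (k + 1)) → a ≤ u 0 → u d ≤ b →
      |∑ k ∈ Finset.range d, A (u k) (u (k + 1)) - A (u 0) (u d)|
        ≤ sewConst θ * C * (u d - u 0) ^ θ := by
  intro d
  induction d using Nat.strong_induction_on with
  | _ d ih =>
  intro u hu ha hb
  rcases Nat.eq_zero_or_pos d with rfl | hd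
  · have h0 := hA.self_eq_zero hθ ⟨ha, hb⟩
    simp [h0, Real.zero_rpow (by linarith : θ ≠ 0)]
  have hL : u 0 ≤ u d := le_of_forall_step_le hu (Nat.zero_le d) le_rfl
  -- Remove the cell containing the midpoint. Both remaining blocks have length at most `L / 2` and
  -- fewer cells, and splitting off the cell costs two defects of `A`.
  obtain ⟨k, hk, hk1, hk2⟩ := exists_crossing (f := u) (c := (u 0 + u d) / 2)
    (by linarith) d hd (by linarith)
  obtain ⟨e, rfl⟩ : ∃ e, d = k + 1 + e := ⟨d - (k + 1), by omega⟩
  set L := u (k + 1 + e) - u 0 with hLdef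
  have hL0 : 0 ≤ L := by linarith
  have m1 : u 0 ≤ u k := le_of_forall_step_le hu (Nat.zero_le k) (by omega)
  have m2 : u k ≤ u (k + 1) := hu k (by omega)
  have m3 : u (k + 1) ≤ u (k + 1 + e) := le_of_forall_step_le hu (by omega) le_rfl
  have I1 := ih k (by omega) u (fun i hi => hu i (by omega)) ha (by linarith)
  have I2 := ih e (by omega) (fun i => u (k + 1 + i))
    (fun i hi => hu (k + 1 + i) (by omega)) (by simpa using by linarith) hb
  have D1 := hA.le_of_le ha m1 (m2.trans m3) hb
  rw [← hLdef] at D1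
  have D2 := hA.le_of_le (ha.trans m1) m2 m3 hb
  have hK : 0 ≤ sewConst θ * C := mul_nonneg (sewConst_pos hθ).le hC
  have hhalf : ∀ x : ℝ, 0 ≤ x → x ≤ L / 2 →
      sewConst θ * C * x ^ θ ≤ sewConst θ * C * (L / 2) ^ θ := fun x h0 hx =>
    mul_le_mul_of_nonneg_left (Real.rpow_le_rpow h0 hx (by linarith)) hK
  have J1 := I1.trans (hhalf _ (by linarith) (by linarith))
  have J2 := I2.trans (hhalf _ (by simpa using by linarith) (by
    simp only [add_zero]; linarith))
  have D2' := D2.trans (mul_le_mul_of_nonneg_left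
    (Real.rpow_le_rpow (by linarith) (by linarith : _ ≤ L) (by linarith : 0 ≤ θ)) hC)
  rw [Finset.sum_range_add, Finset.sum_range_succ]
  simp only [add_zero] at J2
  -- `sewConst θ` is the solution `κ` of `κ = 2 ^ (1 - θ) * κ + 2`, so the induction closes with
  -- equality.
  have hconst : 2 * (sewConst θ * C * (L / 2) ^ θ) + 2 * (C * L ^ θ)
      = sewConst θ * C * L ^ θ := by
    have h1 : (L / 2) ^ θ = L ^ θ * (2 ^ (1 - θ) / 2) := by
      rw [Real.div_rpow hL0 two_pos.le, Real.rpow_sub two_pos, Real.rpow_one]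
      field_simp
    have h2 : 1 - (2 : ℝ) ^ (1 - θ) ≠ 0 := (sub_pos.mpr (two_rpow_one_sub_lt_one hθ)).ne'
    rw [h1, sewConst]
    field_simp
    ring
  rw [← hconst]
  have hshift : ∀ i, u (k + 1 + (i + 1)) = u (k + 1 + i + 1) := fun _ => rfl
  simp only [hshift] at J2
  rw [abs_le] at J1 J2 D1 D2' ⊢
  constructor <;> linarith [J1.1, J1.2, J2.1, J2.2, D1.1, D1.2, D2'.1, D2'.2]

end AlmostAdditive

theorem exists_sorted_enumeration (P : Finset ℝ) : ∃ u : ℕ → ℝ,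
    (∀ i j, i ≤ j → j < P.card → u i ≤ u j) ∧ ∀ t ∈ P, ∃ i < P.card, u i = t := by
  refine ⟨fun i => if h : i < P.card then P.orderEmbOfFin rfl ⟨i, h⟩ else 0, ?_, ?_⟩
  · intro i j hij hj
    simp only [hij.trans_lt hj, hj, dif_pos]
    exact (P.orderEmbOfFin rfl).monotone hij
  · intro t ht
    have : t ∈ Set.range (P.orderEmbOfFin rfl) := by simpa using ht
    obtain ⟨i, rfl⟩ := this
    exact ⟨i, i.2, by simp⟩

/-- An almost additive function is close to the increments of a function on every finite set. -/
theorem exists_primitive_on_finset {A : ℝ → ℝ → ℝ} {θ : ℝ} {C : ℕ → ℝ} (hθ : 1 < θ)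
    (hC : ∀ M, 0 ≤ C M) (hA : ∀ M : ℕ, AlmostAdditive A θ (C M) (-M) M) (P : Finset ℝ) :
    ∃ Z : ℝ → ℝ, Z 0 = 0 ∧ ∀ M : ℕ, ∀ s ∈ P, ∀ t ∈ P, -M ≤ s → s ≤ t → t ≤ M →
      |Z t - Z s - A s t| ≤ sewConst θ * C M * (t - s) ^ θ := by
  obtain ⟨u, hu, hidx⟩ := exists_sorted_enumeration P
  choose! idx hlt hval using hidx
  -- Sum of `A` over the cells of `P` to the left of `t`. If `0 ∉ P`, then `idx 0` is arbitrary, but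
  -- `F 0` only shifts by a constant.
  set F : ℝ → ℝ := fun t => ∑ k ∈ Finset.range (idx t), A (u k) (u (k + 1)) with hF
  refine ⟨fun t => F t - F 0, by simp, ?_⟩
  intro M s hs t ht hMs hst htM
  rcases eq_or_lt_of_le hst with rfl | hlt'
  · have := (hA M).self_eq_zero hθ ⟨hMs, htM⟩
    simp [this, Real.zero_rpow (by linarith : θ ≠ 0)]
  have hij : idx s ≤ idx t := by
    by_contra hcon
    have := hu _ _ (not_le.mp hcon).le (hlt s hs)
    rw [hval s hs, hval t ht] at this
    linarith
  obtain ⟨e, he⟩ := Nat.exists_eq_add_of_le hij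
  have h := (hA M).abs_sum_sub_le hθ (hC M) e (fun i => u (idx s + i))
    (fun k hk => hu _ _ (by omega) (by have := hlt t ht; omega))
    (by simpa [hval s hs] using hMs) (by rw [← he, hval t ht]; exact htM)
  simp only [add_zero, ← he, hval s hs, hval t ht] at h
  have hsum : F t - F s = ∑ k ∈ Finset.range e, A (u (idx s + k)) (u (idx s + (k + 1))) := by
    simp only [hF, he, Finset.sum_range_add, add_sub_cancel_left]
    rfl
  rw [sub_sub_sub_cancel_right, hsum]
  exact h

/-- The sewing lemma on the real line. -/
theorem exists_primitive {A : ℝ → ℝ → ℝ} {θ : ℝ} {C : ℕ → ℝ} (hθ : 1 < θ)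
    (hC : ∀ M, 0 ≤ C M) (hA : ∀ M : ℕ, AlmostAdditive A θ (C M) (-M) M) :
    ∃ Z : ℝ → ℝ, ∀ M : ℕ, ∀ s t : ℝ, -M ≤ s → s ≤ t → t ≤ M →
      |Z t - Z s - A s t| ≤ sewConst θ * C M * (t - s) ^ θ := by
  classical
  choose Z hZ0 hZ using exists_primitive_on_finset hθ hC hA
  -- A compactness argument: along an ultrafilter finer than `atTop`, each point eventually lies in
  -- `P`. Comparison with the point `0` bounds the values independently of `P`, so limits exist and
  -- the closed estimates pass to them.
  let 𝒰 : Ultrafilter (Finset ℝ) := Ultrafilter.of atTop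
  have hmem : ∀ t : ℝ, ∀ᶠ P in (𝒰 : Filter (Finset ℝ)), t ∈ P := fun t =>
    (Ultrafilter.of_le atTop) ((eventually_ge_atTop {t}).mono fun P hP => hP (by simp))
  have hlim : ∀ t : ℝ, ∃ z : ℝ, Tendsto (fun P => Z P t) 𝒰 (𝓝 z) := by
    intro t
    obtain ⟨M, hM⟩ := exists_nat_ge |t|
    rw [abs_le] at hM
    set B : ℝ := |A 0 t| + |A t 0| + sewConst θ * C M * |t| ^ θ with hB
    have hbd : ∀ᶠ P in (𝒰 : Filter (Finset ℝ)), Z P t ∈ Set.Icc (-B) B := by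
      filter_upwards [hmem t, hmem 0] with P ht h0
      rw [Set.mem_Icc, ← abs_le]
      rcases le_total 0 t with h | h
      · have := hZ P M 0 h0 t ht (by simp) h hM.2
        rw [hZ0, sub_zero, sub_zero] at this
        rw [hB, abs_of_nonneg h]
        have h2 := abs_sub_abs_le_abs_sub (Z P t) (A 0 t)
        linarith [abs_nonneg (A t 0)]
      · have := hZ P M t ht 0 h0 hM.1 h (by simp)
        rw [hZ0, zero_sub, zero_sub] at this
        rw [hB, abs_of_nonpos h]
        have h2 := abs_sub_abs_le_abs_sub (-Z P t) (A t 0)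
        rw [abs_neg] at h2
        linarith [abs_nonneg (A 0 t)]
    obtain ⟨z, -, hz⟩ := (isCompact_Icc (a := -B) (b := B)).ultrafilter_le_nhds
      (𝒰.map fun P => Z P t) (le_principal_iff.mpr hbd)
    exact ⟨z, hz⟩
  choose W hW using hlim
  refine ⟨W, fun M s t hs hst ht => ?_⟩
  refine le_of_tendsto (((hW t).sub (hW s)).sub_const _).abs ?_
  filter_upwards [hmem s, hmem t] with P hsP htP
  exact hZ P M s hsP t htP hs hst ht

/-- Increments that agree with `A` up to an error of order `θ > 1` are limits of sums of `A`. -/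
theorem exists_mesh_abs_sum_sub_lt {A : ℝ → ℝ → ℝ} {Z : ℝ → ℝ} {θ C a b : ℝ} (hθ : 1 < θ)
    (hC : 0 ≤ C) (hab : a ≤ b) (h : ∀ s t : ℝ, a ≤ s → s ≤ t → t ≤ b →
      |Z t - Z s - A s t| ≤ C * (t - s) ^ θ) {ε : ℝ} (hε : 0 < ε) :
    ∃ δ > 0, ∀ (N : ℕ) (u : ℕ → ℝ), IsPartition a b δ N u →
      |∑ k ∈ Finset.range N, A (u k) (u (k + 1)) - (Z b - Z a)| < ε := by
  set c : ℝ := C * (b - a) + 1 with hc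
  have hc0 : 0 < c := by have := mul_nonneg hC (sub_nonneg.mpr hab); linarith
  -- With this mesh `δ`, `δ ^ (θ - 1) = ε / c`, so a cell of length `h` contributes at most `C * (ε
  -- / c) * h`. The total is below `ε` because `c` exceeds `C * (b - a)`.
  refine ⟨(ε / c) ^ (1 / (θ - 1)), by positivity, fun N u hu => ?_⟩
  have hstep : ∀ k ∈ Finset.range N, |Z (u (k + 1)) - Z (u k) - A (u k) (u (k + 1))|
      ≤ C * (ε / c) * (u (k + 1) - u k) := by
    intro k hk
    have hk := Finset.mem_range.mp hk
    have h0 : 0 ≤ u (k + 1) - u k := sub_nonneg.mpr (hu.step k hk)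
    refine (h _ _ (hu.mem_Icc hk.le).1 (hu.step k hk) (hu.mem_Icc hk).2).trans ?_
    rw [mul_assoc]
    refine mul_le_mul_of_nonneg_left ?_ hC
    have e1 : (u (k + 1) - u k) ^ θ = (u (k + 1) - u k) ^ (θ - 1) * (u (k + 1) - u k) := by
      rw [← Real.rpow_add_one' h0 (by linarith), sub_add_cancel]
    rw [e1]
    refine mul_le_mul_of_nonneg_right ?_ h0
    have := Real.rpow_le_rpow h0 (hu.mesh k hk).le (by linarith : 0 ≤ θ - 1)
    rwa [← Real.rpow_mul (by positivity), one_div_mul_cancel (by linarith), Real.rpow_one] at this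
  have hsum := (Finset.abs_sum_le_sum_abs _ _).trans (Finset.sum_le_sum hstep)
  rw [Finset.sum_sub_distrib, Finset.sum_range_sub (fun k => Z (u k)), ← Finset.mul_sum,
    Finset.sum_range_sub, hu.left, hu.right] at hsum
  rw [abs_sub_comm]
  refine hsum.trans_lt ?_
  have : ε = c * (ε / c) := by field_simp
  have h3 : 0 < ε / c := by positivity
  calc C * (ε / c) * (b - a) = (c - 1) * (ε / c) := by rw [hc]; ring
    _ < ε := by nlinarith

/-! ### The local expansion -/

theorem tendsto_zero_of_local_bound {F : ℝ → ℝ → ℝ} {β : ℝ} (hβ : 0 < β)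
    (h : ∀ K : Set ℝ, IsCompact K → ∃ C : ℝ, ∀ s ∈ K, ∀ t ∈ K, |F s t| ≤ C * |t - s| ^ β)
    (s : ℝ) : Tendsto (F s) (𝓝 s) (𝓝 0) := by
  obtain ⟨C, hC⟩ := h (Set.Icc (s - 1) (s + 1)) isCompact_Icc
  have h1 : Tendsto (fun t : ℝ => C * |t - s| ^ β) (𝓝 s) (𝓝 0) := by
    have hc : Continuous fun t : ℝ => C * |t - s| ^ β :=
      continuous_const.mul ((continuous_id.sub continuous_const).abs.rpow_const
        fun _ => Or.inr hβ.le)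
    have := hc.tendsto s
    simpa [Real.zero_rpow hβ.ne'] using this
  refine squeeze_zero_norm' ?_ h1
  filter_upwards [Icc_mem_nhds (sub_one_lt s) (lt_add_one s)] with t ht
  exact hC s ⟨by linarith, by linarith⟩ t ht

theorem continuous_of_increments {f : ℝ → ℝ} {G : ℝ → ℝ → ℝ}
    (hG : ∀ s, Tendsto (G s) (𝓝 s) (𝓝 0)) (h : ∀ s t, f t - f s = G s t) : Continuous f := by
  rw [continuous_iff_continuousAt]
  intro s
  have := (hG s).const_add (f s)
  rw [add_zero] at this
  exact this.congr fun t => by rw [← h s t]; ring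

theorem exists_nonneg_bound {F G : ℝ → ℝ → ℝ} {K : Set ℝ} (hG : ∀ s t, 0 ≤ G s t)
    (h : ∃ C : ℝ, ∀ s ∈ K, ∀ t ∈ K, F s t ≤ C * G s t) :
    ∃ C : ℝ, 0 ≤ C ∧ ∀ s ∈ K, ∀ t ∈ K, F s t ≤ C * G s t := by
  obtain ⟨C, hC⟩ := h
  exact ⟨max C 0, le_max_right _ _, fun s hs t ht =>
    (hC s hs t ht).trans (mul_le_mul_of_nonneg_right (le_max_left _ _) (hG s t))⟩

namespace RoughPath

variable {α : ℝ} {n : ℕ} (R : RoughPath α n) {Y : ℝ → ℝ} {Y' : ℝ → Fin n → ℝ}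

theorem tendsto_X (hα : 0 < α) (j : Fin n) (s : ℝ) :
    Tendsto (fun t => R.X t j - R.X s j) (𝓝 s) (𝓝 0) := by
  refine tendsto_zero_of_local_bound (F := fun s t => R.X t j - R.X s j) hα (fun K hK => ?_) s
  obtain ⟨C, hC⟩ := R.holder K hK
  exact ⟨C, fun s hs t ht => (norm_le_pi_norm (R.X t - R.X s) j).trans (hC s hs t ht)⟩

theorem abs_XX_le_norm (s t : ℝ) (i j : Fin n) : |R.XX s t i j| ≤ ‖R.XX s t‖ :=
  (norm_le_pi_norm (R.XX s t i) j).trans (norm_le_pi_norm (R.XX s t) i)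

theorem tendsto_XX (hα : 0 < α) (i j : Fin n) (s : ℝ) :
    Tendsto (fun t => R.XX s t i j) (𝓝 s) (𝓝 0) := by
  refine tendsto_zero_of_local_bound (F := fun s t => R.XX s t i j) (β := 2 * α) (by linarith)
    (fun K hK => ?_) s
  obtain ⟨C, hC⟩ := R.holder_two K hK
  exact ⟨C, fun s hs t ht => (R.abs_XX_le_norm s t i j).trans (hC s hs t ht)⟩

theorem continuous_X (hα : 0 < α) (j : Fin n) : Continuous fun t => R.X t j :=
  continuous_of_increments (G := fun s t => R.X t j - R.X s j) (R.tendsto_X hα j)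
    fun _ _ => rfl

/-- By Chen's relation the increment of `𝕏_{x,·}` from `s` to `t` is `𝕏_{s,t} + X_{x,s} X_{s,t}`,
which tends to zero as `t → s`. -/
theorem continuous_XX (hα : 0 < α) (x : ℝ) (i j : Fin n) : Continuous fun t => R.XX x t i j := by
  refine continuous_of_increments
    (G := fun s t => R.XX s t i j + (R.X s i - R.X x i) * (R.X t j - R.X s j)) (fun s => ?_)
    fun s t => by linarith [R.chen x s t i j]
  simpa using (R.tendsto_XX hα i j s).add ((R.tendsto_X hα j s).const_mul (R.X s i - R.X x i))

theorem tendsto_germ (hα : 0 < α) (j : Fin n) (s : ℝ) :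
    Tendsto (R.germ Y Y' j s) (𝓝 s) (𝓝 0) := by
  have h := ((R.tendsto_X hα j s).const_mul (Y s)).add
    (tendsto_finsetSum Finset.univ fun i _ => (R.tendsto_XX hα i j s).const_mul (Y' s i))
  simp only [mul_zero, Finset.sum_const_zero, add_zero] at h
  exact h

/-- The term `Y'_i(s) X^i_{s,u} X^j_{u,t}` produced by Chen's relation cancels the first-order part
of `Y_u - Y_s`. Only second-order quantities times first-order ones survive. -/
theorem germ_sub_germ_sub_germ (j : Fin n) (s u t : ℝ) :
    R.germ Y Y' j s t - R.germ Y Y' j s u - R.germ Y Y' j u t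
      = -((Y u - Y s - ∑ i, Y' s i * (R.X u i - R.X s i)) * (R.X t j - R.X u j)
        + ∑ i, (Y' u i - Y' s i) * R.XX u t i j) := by
  have h : ∀ i, R.XX s t i j
      = R.XX s u i j + R.XX u t i j + (R.X u i - R.X s i) * (R.X t j - R.X u j) :=
    fun i => by linarith [R.chen s u t i j]
  simp only [germ, h, mul_add, Finset.sum_add_distrib, sub_mul (_ : ℝ) _ (R.XX _ _ _ _),
    Finset.sum_sub_distrib, ← mul_assoc, ← Finset.sum_mul]
  ring

/-- The germ is additive up to a remainder of order `3α`. -/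
theorem exists_germ_bound (hY : R.IsControlled Y Y') (j : Fin n) {K : Set ℝ}
    (hK : IsCompact K) : ∃ C : ℝ, 0 ≤ C ∧ ∀ s ∈ K, ∀ u ∈ K, ∀ t ∈ K,
      |R.germ Y Y' j s t - R.germ Y Y' j s u - R.germ Y Y' j u t|
        ≤ C * (|u - s| ^ (2 * α) * |t - u| ^ α + |u - s| ^ α * |t - u| ^ (2 * α)) := by
  obtain ⟨C₁, h₁, hC₁⟩ := exists_nonneg_bound (G := fun s t => |t - s| ^ (2 * α))
    (fun s t => by positivity) (hY.remainder K hK)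
  obtain ⟨C₂, h₂, hC₂⟩ := exists_nonneg_bound (G := fun s t => |t - s| ^ α)
    (fun s t => by positivity) (R.holder K hK)
  obtain ⟨C₃, h₃, hC₃⟩ := exists_nonneg_bound (G := fun s t => |t - s| ^ α)
    (fun s t => by positivity) (hY.holder K hK)
  obtain ⟨C₄, h₄, hC₄⟩ := exists_nonneg_bound (G := fun s t => |t - s| ^ (2 * α))
    (fun s t => by positivity) (R.holder_two K hK)
  -- The powers of `|u - s|` and `|t - u|` are kept apart because the reconstruction bound needs a
  -- factor `|t - u| ^ α` by itself.
  refine ⟨C₁ * C₂ + n * (C₃ * C₄), by positivity, fun s hs u hu t ht => ?_⟩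
  rw [germ_sub_germ_sub_germ, abs_neg]
  have e1 : |(Y u - Y s - ∑ i, Y' s i * (R.X u i - R.X s i)) * (R.X t j - R.X u j)|
      ≤ C₁ * |u - s| ^ (2 * α) * (C₂ * |t - u| ^ α) := by
    rw [abs_mul]
    exact mul_le_mul (hC₁ s hs u hu)
      ((norm_le_pi_norm (R.X t - R.X u) j).trans (hC₂ u hu t ht)) (abs_nonneg _) (by positivity)
  have e2 : |∑ i, (Y' u i - Y' s i) * R.XX u t i j|
      ≤ n * (C₃ * |u - s| ^ α * (C₄ * |t - u| ^ (2 * α))) := by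
    refine (Finset.abs_sum_le_sum_abs _ _).trans ?_
    have hterm : ∀ i ∈ (Finset.univ : Finset (Fin n)), |(Y' u i - Y' s i) * R.XX u t i j|
        ≤ C₃ * |u - s| ^ α * (C₄ * |t - u| ^ (2 * α)) := by
      intro i _
      rw [abs_mul]
      exact mul_le_mul ((norm_le_pi_norm (Y' u - Y' s) i).trans (hC₃ s hs u hu))
        ((R.abs_XX_le_norm u t i j).trans (hC₄ u hu t ht)) (abs_nonneg _) (by positivity)
    simpa using Finset.sum_le_sum hterm
  refine (abs_add_le _ _).trans ((add_le_add e1 e2).trans ?_)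
  have p1 : 0 ≤ |u - s| ^ (2 * α) * |t - u| ^ α := by positivity
  have p2 : 0 ≤ |u - s| ^ α * |t - u| ^ (2 * α) := by positivity
  have q1 : 0 ≤ C₁ * C₂ := by positivity
  have q2 : 0 ≤ n * (C₃ * C₄) := by positivity
  nlinarith [mul_nonneg q1 p2, mul_nonneg q2 p1]

theorem exists_germ_almostAdditive (hα : 0 < α) (hY : R.IsControlled Y Y') (j : Fin n)
    (a b : ℝ) : ∃ C : ℝ, 0 ≤ C ∧ AlmostAdditive (R.germ Y Y' j) (3 * α) C a b := by
  obtain ⟨C, h0, hC⟩ := R.exists_germ_bound hY j (isCompact_Icc (a := a) (b := b))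
  refine ⟨C * 2, by positivity, fun s hs u hu t ht => (hC s hs u hu t ht).trans ?_⟩
  rw [mul_assoc]
  refine mul_le_mul_of_nonneg_left ?_ h0
  have hl : |u - s| ≤ |u - s| + |t - u| := by linarith [abs_nonneg (t - u)]
  have hr : |t - u| ≤ |u - s| + |t - u| := by linarith [abs_nonneg (u - s)]
  set D := |u - s| + |t - u|
  have hD : 0 ≤ D := (abs_nonneg _).trans hl
  have hsplit : D ^ (3 * α) = D ^ (2 * α) * D ^ α := by
    rw [← Real.rpow_add_of_nonneg hD (by linarith) hα.le]
    congr 1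
    ring
  have hp : ∀ x β : ℝ, 0 < β → |x| ≤ D → |x| ^ β ≤ D ^ β := fun x β hβ hx =>
    Real.rpow_le_rpow (abs_nonneg _) hx hβ.le
  have e1 := mul_le_mul (hp _ (2 * α) (by linarith) hl) (hp _ α hα hr)
    (by positivity) (by positivity)
  have e2 := mul_le_mul (hp _ α hα hl) (hp _ (2 * α) (by linarith) hr)
    (by positivity) (by positivity)
  rw [hsplit]
  linarith

/-- The rough integral exists, with the local expansion given by the germ. -/
theorem exists_rough_integral (hα : 1 / 3 < α) (hY : R.IsControlled Y Y') (j : Fin n) :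
    ∃ Z : ℝ → ℝ,
      (∀ K : Set ℝ, IsCompact K → ∃ C : ℝ, ∀ s ∈ K, ∀ t ∈ K,
        |Z t - Z s - R.germ Y Y' j s t| ≤ C * |t - s| ^ (3 * α)) ∧
      R.IsRoughIntegral Y Y' j Z := by
  have hα0 : 0 < α := by linarith
  have hθ : 1 < 3 * α := by linarith
  choose C hC0 hC using fun M : ℕ => R.exists_germ_almostAdditive hα0 hY j (-M) M
  obtain ⟨Z, hZ⟩ := exists_primitive hθ hC0 hC
  have hS := sewConst_pos hθ
  refine ⟨Z, fun K hK => ?_, fun s t hst ε hε => ?_⟩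
  · obtain ⟨B, hB⟩ := hK.isBounded.subset_closedBall 0
    obtain ⟨M, hM⟩ := exists_nat_ge B
    have hKM : ∀ s ∈ K, s ∈ Set.Icc (-M : ℝ) M := by
      intro s hs
      have h := hB hs
      rw [mem_closedBall_zero_iff, Real.norm_eq_abs] at h
      exact abs_le.mp (h.trans hM)
    -- The second summand serves the case `t ≤ s`: the defect of the triple `(s, t, s)`, with `A s s
    -- = 0`, compares `A s t` with `-A t s` at total length `2 |t - s|`.
    refine ⟨sewConst (3 * α) * C M + C M * 2 ^ (3 * α), fun s hs t ht => ?_⟩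
    have hsM := hKM s hs
    have htM := hKM t ht
    have hnn : 0 ≤ C M * 2 ^ (3 * α) * |t - s| ^ (3 * α) :=
      mul_nonneg (mul_nonneg (hC0 M) (by positivity)) (by positivity)
    rw [add_mul]
    rcases le_total s t with h | h
    · have := hZ M s t hsM.1 h htM.2
      rw [← abs_of_nonneg (sub_nonneg.mpr h)] at this
      linarith
    · have h1 := hZ M t s htM.1 h hsM.2
      have h2 := hC M s hsM t htM s hsM
      rw [(hC M).self_eq_zero hθ hsM, abs_sub_comm s t, ← two_mul,
        Real.mul_rpow two_pos.le (abs_nonneg _), ← mul_assoc] at h2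
      rw [← abs_of_nonneg (sub_nonneg.mpr h), abs_sub_comm s t] at h1
      rw [abs_le] at h1 h2 ⊢
      constructor <;> linarith [h1.1, h1.2, h2.1, h2.2]
  · obtain ⟨M, hM⟩ := exists_nat_ge (max |s| |t|)
    have hsM := abs_le.mp ((le_max_left _ _).trans hM)
    have htM := abs_le.mp ((le_max_right _ _).trans hM)
    exact exists_mesh_abs_sum_sub_lt hθ (mul_nonneg hS.le (hC0 M)) hst
      (fun p q hp hpq hq => hZ M p q (hsM.1.trans hp) hpq (hq.trans htM.2)) hε

/-! ### The modelled distribution -/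

theorem groupAction_vec (x : Fin n → ℝ) (σ : Symb n) :
    groupAction x (vec σ) = groupActionSymb x σ := by
  simp [groupAction, vec, Fintype.linearCombination_apply_single]

/-- `Γ_{xy}` moves `-Y'_i(y) X^i_{x,y}` into the coefficient of `Ξ_j`. The two resulting
coefficients are exactly the quantities bounded in `IsControlled`, with base point `y`. -/
theorem mulXi_sub_Gam (j : Fin n) (x y : ℝ) :
    mulXi Y Y' j x - R.Gam x y (mulXi Y Y' j y)
      = (Y x - Y y - ∑ i, Y' y i * (R.X x i - R.X y i)) • vec (.Xi j)
        + ∑ i, (Y' x i - Y' y i) • vec (.WXi i j) := by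
  simp only [mulXi, Gam, map_add, map_sum, map_smul, groupAction_vec, groupActionSymb,
    Pi.sub_apply, smul_sub, sub_smul, Finset.sum_sub_distrib, Finset.sum_smul, smul_smul, mul_sub]
  abel

theorem smul_vec_Xi_add_sum_apply (c : ℝ) (d : Fin n → ℝ) (j : Fin n) (σ : Symb n) :
    (c • vec (.Xi j) + ∑ i, d i • vec (.WXi i j) : ModelSpace n) σ
      = match σ with
        | .one => 0
        | .W _ => 0
        | .Xi k => if k = j then c else 0
        | .WXi i k => if k = j then d i else 0 := by
  cases σ with
  | one => simp [vec]
  | W i => simp [vec]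
  | Xi k => simp [vec, Pi.single_apply]
  | WXi i k =>
    by_cases h : k = j <;> simp [vec, Pi.single_apply, h]

theorem mulXi_mem_modelled (hα : 1 / 3 < α) (hY : R.IsControlled Y Y') (j : Fin n) :
    mulXi Y Y' j ∈ R.modelled (3 * α - 1) := by
  refine ⟨fun x σ hσ => ?_, fun K hK β hβ => ?_⟩
  -- The degrees `α - 1` and `2α - 1` lie below `3α - 1`, so only symbols with zero coefficient can
  -- be truncated.
  · rw [mulXi, smul_vec_Xi_add_sum_apply]
    cases σ with
    | one => rfl
    | W i => rfl
    | Xi k => simp only [Symb.deg] at hσ; linarith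
    | WXi i k => simp only [Symb.deg] at hσ; linarith
  have hcomp : ∀ σ : Symb n, ∃ C : ℝ, ∀ x ∈ K, ∀ y ∈ K,
      |(mulXi Y Y' j x - R.Gam x y (mulXi Y Y' j y)) σ|
        ≤ C * |x - y| ^ (3 * α - 1 - σ.deg α) := by
    intro σ
    simp only [mulXi_sub_Gam, smul_vec_Xi_add_sum_apply]
    cases σ with
    | one => exact ⟨0, fun x _ y _ => by simp⟩
    | W i => exact ⟨0, fun x _ y _ => by simp⟩
    | Xi k =>
      by_cases hk : k = j
      · obtain ⟨C, hC⟩ := hY.remainder K hK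
        refine ⟨C, fun x hx y hy => ?_⟩
        simp only [hk, if_true, Symb.deg]
        rw [show 3 * α - 1 - (α - 1) = 2 * α by ring]
        exact hC y hy x hx
      · exact ⟨0, fun x _ y _ => by simp [hk]⟩
    | WXi i k =>
      by_cases hk : k = j
      · obtain ⟨C, hC⟩ := hY.holder K hK
        refine ⟨C, fun x hx y hy => ?_⟩
        simp only [hk, if_true, Symb.deg]
        rw [show 3 * α - 1 - (2 * α - 1) = α by ring]
        exact (norm_le_pi_norm (Y' x - Y' y) i).trans (hC y hy x hx)
      · exact ⟨0, fun x _ y _ => by simp [hk]⟩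
  choose C hC using hcomp
  classical
  refine ⟨∑ σ : Symb n with σ.deg α = β, C σ, fun x hx y hy => ?_⟩
  rw [compNorm, Finset.sum_mul]
  convert Finset.sum_le_sum (s := Finset.univ.filter fun σ : Symb n => σ.deg α = β)
    (f := fun σ => |(mulXi Y Y' j x - R.Gam x y (mulXi Y Y' j y)) σ|)
    (g := fun σ => C σ * |x - y| ^ (3 * α - 1 - β)) ?_
  intro σ hσ
  rw [← (Finset.mem_filter.mp hσ).2]
  exact hC σ x hx y hy

end RoughPath

/-! ### Linearity of the Stieltjes integral in the integrator -/

theorem integrable_deriv_mul (ψ : TestFn) {g : ℝ → ℝ} (hg : Continuous g) :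
    MeasureTheory.Integrable fun t => deriv ψ t * g t := by
  have hψd : ContDiff ℝ 1 ψ := ψ.contDiff.of_le (by exact_mod_cast le_top)
  exact ((hψd.continuous_deriv le_rfl).mul hg).integrable_of_hasCompactSupport
    ψ.hasCompactSupport.deriv.mul_right

theorem stieltjes_add {f g : ℝ → ℝ} (hf : Continuous f) (hg : Continuous g) :
    stieltjes (fun t => f t + g t) = stieltjes f + stieltjes g := by
  ext ψ
  change stieltjes (fun t => f t + g t) ψ = stieltjes f ψ + stieltjes g ψ
  have hfg : Continuous fun t => f t + g t := hf.add hg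
  rw [stieltjes_apply hfg, stieltjes_apply hf, stieltjes_apply hg, ← neg_add,
    ← MeasureTheory.integral_add (integrable_deriv_mul ψ hf) (integrable_deriv_mul ψ hg)]
  simp only [mul_add]

theorem stieltjes_const_mul (c : ℝ) {f : ℝ → ℝ} (hf : Continuous f) :
    stieltjes (fun t => c * f t) = c • stieltjes f := by
  ext ψ
  change stieltjes (fun t => c * f t) ψ = c * stieltjes f ψ
  have hcf : Continuous fun t => c * f t := continuous_const.mul hf
  rw [stieltjes_apply hcf, stieltjes_apply hf, mul_neg,
    ← MeasureTheory.integral_const_mul]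
  simp only [mul_left_comm]

theorem stieltjes_sum {ι : Type*} (s : Finset ι) {f : ι → ℝ → ℝ} (hf : ∀ i, Continuous (f i)) :
    stieltjes (fun t => ∑ i ∈ s, f i t) = ∑ i ∈ s, stieltjes (f i) := by
  classical
  induction s using Finset.induction_on with
  | empty =>
    have := stieltjes_const_mul 0 (continuous_const (y := (0 : ℝ)) (X := ℝ))
    simpa using this
  | insert i s hi ih =>
    simp only [Finset.sum_insert hi]
    rw [stieltjes_add (hf i) (continuous_finsetSum s fun k _ => hf k), ih]

theorem stieltjes_sub {f g : ℝ → ℝ} (hf : Continuous f) (hg : Continuous g) :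
    stieltjes (fun t => f t - g t) = stieltjes f - stieltjes g := by
  have hg' : Continuous fun t => -1 * g t := continuous_const.mul hg
  have h := stieltjes_add hf hg'
  rw [stieltjes_const_mul _ hg] at h
  simpa [sub_eq_add_neg] using h

/-! ### Young's bound -/

theorem isPartition_uniform {a b δ : ℝ} (hab : a ≤ b) {N : ℕ} (hN : 0 < N)
    (hδ : (b - a) / N < δ) : IsPartition a b δ N fun k => a + k * ((b - a) / N) where
  left := by simp
  right := by
    have : (N : ℝ) ≠ 0 := by positivity
    field_simp
    ring
  step k _ := by
    have : 0 ≤ (b - a) / N := div_nonneg (sub_nonneg.mpr hab) (by positivity)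
    push_cast
    linarith
  mesh k _ := by
    push_cast
    linarith

/-- The germ `ψ s * (g t - g s)` has defect `-(ψ u - ψ s) * (g t - g u)`, of order `ρ + α > 1`.
Since `ψ a = 0`, it vanishes on the whole interval, so the sewing estimate bounds the Riemann sums
themselves, uniformly in the partition. -/
theorem abs_stieltjes_le {g : ℝ → ℝ} (hg : Continuous g) (ψ : TestFn) {a b P Q ρ α : ℝ}
    (hab : a ≤ b) (hsupp : tsupport ψ ⊆ Set.Icc a b) (ha : ψ a = 0) (hP : 0 ≤ P) (hQ : 0 ≤ Q)
    (hρ : 0 < ρ) (hα : 0 < α) (hθ : 1 < ρ + α)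
    (hψ : ∀ s ∈ Set.Icc a b, ∀ t ∈ Set.Icc a b, |ψ t - ψ s| ≤ P * |t - s| ^ ρ)
    (hgα : ∀ s ∈ Set.Icc a b, ∀ t ∈ Set.Icc a b, |g t - g s| ≤ Q * |t - s| ^ α) :
    |stieltjes g ψ| ≤ sewConst (ρ + α) * (P * Q) * (b - a) ^ (ρ + α) := by
  have hA : AlmostAdditive (fun s t => ψ s * (g t - g s)) (ρ + α) (P * Q) a b := by
    intro s hs u hu t ht
    have e : ψ s * (g t - g s) - ψ s * (g u - g s) - ψ u * (g t - g u)
        = -((ψ u - ψ s) * (g t - g u)) := by ring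
    rw [e, abs_neg, abs_mul]
    have hl : |u - s| ≤ |u - s| + |t - u| := by linarith [abs_nonneg (t - u)]
    have hr : |t - u| ≤ |u - s| + |t - u| := by linarith [abs_nonneg (u - s)]
    have h1 := (hψ s hs u hu).trans (mul_le_mul_of_nonneg_left
      (Real.rpow_le_rpow (abs_nonneg _) hl hρ.le) hP)
    have h2 := (hgα u hu t ht).trans (mul_le_mul_of_nonneg_left
      (Real.rpow_le_rpow (abs_nonneg _) hr hα.le) hQ)
    refine (mul_le_mul h1 h2 (abs_nonneg _) (by positivity)).trans (le_of_eq ?_)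
    rw [Real.rpow_add_of_nonneg (by positivity) hρ.le hα.le]
    ring
  refine le_of_forall_pos_le_add fun ε hε => ?_
  obtain ⟨δ, hδ, h⟩ := hasStieltjesIntegral_stieltjes hg ψ a b hab hsupp ε hε
  obtain ⟨N, hN⟩ := exists_nat_gt ((b - a) / δ)
  have hN0 : (0 : ℝ) < N := lt_of_le_of_lt (div_nonneg (sub_nonneg.mpr hab) hδ.le) hN
  have hmesh : (b - a) / N < δ := by
    rw [div_lt_iff₀ hδ] at hN
    rw [div_lt_iff₀ hN0]
    linarith
  have hu := isPartition_uniform hab (by exact_mod_cast hN0) hmesh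
  set u : ℕ → ℝ := fun k => a + k * ((b - a) / N)
  have h1 := h N u u hu fun k hk => ⟨le_rfl, hu.step k hk⟩
  have h2 := hA.abs_sum_sub_le hθ (mul_nonneg hP hQ) N u hu.step hu.left.ge hu.right.le
  rw [hu.left, hu.right, ha, zero_mul, sub_zero] at h2
  rw [abs_lt] at h1
  rw [abs_le] at h2 ⊢
  constructor <;> linarith [h1.1, h1.2, h2.1, h2.2]

/-! ### Rescaled test functions -/

/-- For `r ≤ 1` this is the Hölder clause of order `0`; for `r > 1` the bound on the first
derivative gives a Lipschitz estimate. -/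
theorem InBall.abs_sub_le {r : ℝ} {φ : TestFn} (h : InBall r φ) (hr : 0 < r) (s t : ℝ) :
    |φ t - φ s| ≤ |t - s| ^ min r 1 := by
  rcases le_or_gt r 1 with h1 | h1
  · have := h.holder 0 (by simpa using hr) (by simpa using h1) s t
    simpa [min_eq_left h1] using this
  · have hd : Differentiable ℝ φ := φ.contDiff.differentiable (by simp)
    have hb : ∀ x ∈ Set.univ, ‖deriv φ x‖ ≤ 1 := fun x _ => by
      have := h.bound 1 (by simpa using h1) x
      simpa [iteratedDeriv_one] using this
    have := Convex.norm_image_sub_le_of_norm_deriv_le (fun x _ => hd x) hb convex_univ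
      (Set.mem_univ s) (Set.mem_univ t)
    simpa [min_eq_right h1.le] using this

theorem rescale_apply (φ : TestFn) (x l : ℝ) (hl : 0 < l) (y : ℝ) :
    rescale φ x l hl y = l⁻¹ * φ (l⁻¹ * (y - x)) := rfl

theorem rescale_eq_zero {φ : TestFn} (hφ : tsupport φ ⊆ Metric.closedBall (0 : ℝ) 1) {x l : ℝ}
    (hl : 0 < l) {y : ℝ} (hy : l < |y - x|) : rescale φ x l hl y = 0 := by
  suffices hnot : l⁻¹ * (y - x) ∉ tsupport φ by
    rw [rescale_apply, image_eq_zero_of_notMem_tsupport hnot, mul_zero]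
  intro hmem
  have h := hφ hmem
  rw [mem_closedBall_zero_iff, norm_mul, norm_inv, Real.norm_eq_abs, Real.norm_eq_abs,
    abs_of_pos hl, inv_mul_le_iff₀ hl, mul_one] at h
  linarith

/-- The radius `2 * l` instead of `l` leaves room for the function to vanish at the endpoints, as
Young's bound requires. -/
theorem tsupport_rescale_subset {φ : TestFn} (hφ : tsupport φ ⊆ Metric.closedBall (0 : ℝ) 1)
    {x l : ℝ} (hl : 0 < l) :
    tsupport (rescale φ x l hl) ⊆ Set.Icc (x - 2 * l) (x + 2 * l) := by
  refine closure_minimal (fun y hy => ?_) isClosed_Icc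
  by_contra hcon
  refine hy (rescale_eq_zero hφ hl ?_)
  by_contra hle
  have := abs_le.mp (not_lt.mp hle)
  exact hcon ⟨by linarith [this.1], by linarith [this.2]⟩

theorem InBall.abs_rescale_sub_le {r : ℝ} {φ : TestFn} (h : InBall r φ) (hr : 0 < r)
    {x l : ℝ} (hl : 0 < l) (s t : ℝ) :
    |rescale φ x l hl t - rescale φ x l hl s|
      ≤ l⁻¹ * l⁻¹ ^ min r 1 * |t - s| ^ min r 1 := by
  have h1 := h.abs_sub_le hr (l⁻¹ * (s - x)) (l⁻¹ * (t - x))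
  rw [← mul_sub, sub_sub_sub_cancel_right, abs_mul, abs_of_pos (inv_pos.mpr hl),
    Real.mul_rpow (inv_pos.mpr hl).le (abs_nonneg _)] at h1
  rw [rescale_apply, rescale_apply, ← mul_sub, abs_mul, abs_of_pos (inv_pos.mpr hl), mul_assoc]
  exact mul_le_mul_of_nonneg_left h1 (inv_pos.mpr hl).le

/-! ### The reconstruction -/

namespace RoughPath

variable {α : ℝ} {n : ℕ} (R : RoughPath α n) {Y : ℝ → ℝ} {Y' : ℝ → Fin n → ℝ}

theorem PiMap_mulXi (j : Fin n) (x : ℝ) :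
    R.PiMap x (mulXi Y Y' j x) = Y x • stieltjes (fun t => R.X t j)
      + ∑ i, Y' x i • stieltjes fun t => R.XX x t i j := by
  have h : ∀ σ : Symb n, R.PiMap x (vec σ) = R.PiSymb x σ := fun σ => by
    simp [PiMap, vec, Fintype.linearCombination_apply_single]
  simp only [mulXi, map_add, map_sum, map_smul, h, PiSymb]

/-- Gathers the error into one integrator, to which Young's bound applies. -/
theorem stieltjes_sub_PiMap_mulXi (hα : 0 < α) {Z : ℝ → ℝ} (hZ : Continuous Z) (j : Fin n)
    (x : ℝ) : stieltjes Z - R.PiMap x (mulXi Y Y' j x)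
      = stieltjes fun t => Z t - (Y x * R.X t j + ∑ i, Y' x i * R.XX x t i j) := by
  have hX := R.continuous_X hα j
  have hXX := fun i => R.continuous_XX hα x i j
  have hYX : Continuous fun t => Y x * R.X t j := continuous_const.mul hX
  have hc : ∀ i, Continuous fun t => Y' x i * R.XX x t i j := fun i =>
    continuous_const.mul (hXX i)
  have hsum : Continuous fun t => ∑ i, Y' x i * R.XX x t i j :=
    continuous_finsetSum _ fun i _ => hc i
  have hall : Continuous fun t => Y x * R.X t j + ∑ i, Y' x i * R.XX x t i j := hYX.add hsum
  rw [stieltjes_sub hZ hall, stieltjes_add hYX hsum,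
    stieltjes_const_mul _ hX, stieltjes_sum _ hc, PiMap_mulXi]
  simp only [stieltjes_const_mul _ (hXX _)]

theorem isReconstruction_stieltjes (hα : 1 / 3 < α) (hY : R.IsControlled Y Y') (j : Fin n)
    {Z : ℝ → ℝ} (hZ : ∀ K : Set ℝ, IsCompact K → ∃ C : ℝ, ∀ s ∈ K, ∀ t ∈ K,
      |Z t - Z s - R.germ Y Y' j s t| ≤ C * |t - s| ^ (3 * α))
    (hZc : Continuous Z) {r : ℝ} (hr0 : 0 < r) (hr : 1 - α < r) :
    R.IsReconstruction r (3 * α - 1) (mulXi Y Y' j) (stieltjes Z) := by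
  have hα0 : 0 < α := by linarith
  intro K hK
  obtain ⟨B, hB⟩ := hK.isBounded.subset_closedBall 0
  -- The margin `2` contains every interval `[x - 2l, x + 2l]` with `x ∈ K` and `l ≤ 1`.
  set K₂ : Set ℝ := Set.Icc (-(B + 2)) (B + 2) with hK₂
  obtain ⟨C₁, h₁, hC₁⟩ := exists_nonneg_bound (G := fun s t => |t - s| ^ (3 * α))
    (fun s t => by positivity) (hZ K₂ isCompact_Icc)
  obtain ⟨C₂, h₂, hC₂⟩ := R.exists_germ_bound hY j (isCompact_Icc : IsCompact K₂)
  set ρ : ℝ := min r 1 with hρdef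
  have hρ0 : 0 < ρ := lt_min hr0 one_pos
  have hθ : 1 < ρ + α := by
    have : 1 - α < ρ := lt_min hr (by linarith)
    linarith
  refine ⟨sewConst (ρ + α) * (C₁ + 2 * C₂) * 4 ^ (3 * α + ρ), fun x hx φ hφ l hl hl1 => ?_⟩
  have hxB : |x| ≤ B := by
    have := hB hx
    rwa [mem_closedBall_zero_iff, Real.norm_eq_abs] at this
  rw [abs_le] at hxB
  have hsub : ∀ s ∈ Set.Icc (x - 2 * l) (x + 2 * l), s ∈ K₂ := fun s hs =>
    ⟨by linarith [hs.1], by linarith [hs.2]⟩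
  have hxm : x ∈ Set.Icc (x - 2 * l) (x + 2 * l) := ⟨by linarith, by linarith⟩
  rw [R.stieltjes_sub_PiMap_mulXi hα0 hZc]
  set g : ℝ → ℝ := fun t => Z t - (Y x * R.X t j + ∑ i, Y' x i * R.XX x t i j) with hgdef
  have hg : Continuous g := hZc.sub ((continuous_const.mul (R.continuous_X hα0 j)).add
    (continuous_finsetSum _ fun i _ => continuous_const.mul (R.continuous_XX hα0 x i j)))
  -- Sewing remainder on `[s, t]` minus the defect of the germ at the triple `(x, s, t)`.
  have hginc : ∀ s t, g t - g s = (Z t - Z s - R.germ Y Y' j s t)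
      - (R.germ Y Y' j x t - R.germ Y Y' j x s - R.germ Y Y' j s t) := by
    intro s t
    simp only [hgdef, germ]
    ring
  have hl4 : 0 < 4 * l := by linarith
  have hgα : ∀ s ∈ Set.Icc (x - 2 * l) (x + 2 * l), ∀ t ∈ Set.Icc (x - 2 * l) (x + 2 * l),
      |g t - g s| ≤ (C₁ + 2 * C₂) * (4 * l) ^ (2 * α) * |t - s| ^ α := by
    intro s hs t ht
    have hts : |t - s| ≤ 4 * l := abs_le.mpr ⟨by linarith [ht.1, hs.2], by linarith [ht.2, hs.1]⟩
    have hsx : |s - x| ≤ 4 * l := abs_le.mpr ⟨by linarith [hs.1], by linarith [hs.2]⟩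
    have b1 := hC₁ s (hsub s hs) t (hsub t ht)
    have b2 := hC₂ x (hsub x hxm) s (hsub s hs) t (hsub t ht)
    have hp : ∀ y β : ℝ, 0 < β → |y| ≤ 4 * l → |y| ^ β ≤ (4 * l) ^ β := fun y β hβ hy =>
      Real.rpow_le_rpow (abs_nonneg _) hy hβ.le
    have hadd : ∀ y : ℝ, 0 ≤ y → y ^ (2 * α) = y ^ α * y ^ α := fun y hy => by
      rw [← Real.rpow_add_of_nonneg hy hα0.le hα0.le, two_mul]
    have p0 : 0 ≤ |t - s| ^ α := by positivity
    have e1 : |t - s| ^ (3 * α) ≤ (4 * l) ^ (2 * α) * |t - s| ^ α := by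
      have : |t - s| ^ (3 * α) = |t - s| ^ (2 * α) * |t - s| ^ α := by
        rw [← Real.rpow_add_of_nonneg (abs_nonneg _) (by linarith) hα0.le]
        congr 1
        ring
      rw [this]
      exact mul_le_mul_of_nonneg_right (hp _ _ (by linarith) hts) p0
    have e2 : |s - x| ^ (2 * α) * |t - s| ^ α ≤ (4 * l) ^ (2 * α) * |t - s| ^ α :=
      mul_le_mul_of_nonneg_right (hp _ _ (by linarith) hsx) p0
    have e3 : |s - x| ^ α * |t - s| ^ (2 * α) ≤ (4 * l) ^ (2 * α) * |t - s| ^ α := by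
      rw [hadd _ (abs_nonneg (t - s)), hadd _ hl4.le, ← mul_assoc]
      exact mul_le_mul_of_nonneg_right
        (mul_le_mul (hp _ _ hα0 hsx) (hp _ _ hα0 hts) p0 (by positivity)) p0
    rw [hginc]
    refine (abs_sub _ _).trans ((add_le_add b1 b2).trans ?_)
    have f1 := mul_le_mul_of_nonneg_left e1 h₁
    have f2 := mul_le_mul_of_nonneg_left (add_le_add e2 e3) h₂
    linarith
  have hY0 := abs_stieltjes_le hg (rescale φ x l hl) (by linarith)
    (tsupport_rescale_subset hφ.support hl)
    (rescale_eq_zero hφ.support hl (by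
      rw [sub_sub_cancel_left, abs_neg, abs_of_pos (by linarith)]; linarith))
    (P := l⁻¹ * l⁻¹ ^ ρ) (Q := (C₁ + 2 * C₂) * (4 * l) ^ (2 * α)) (by positivity) (by positivity)
    hρ0 hα0 hθ (fun s _ t _ => hφ.abs_rescale_sub_le hr0 hl s t) hgα
  refine hY0.trans (le_of_eq ?_)
  have hlen : x + 2 * l - (x - 2 * l) = 4 * l := by ring
  rw [hlen]
  have e1 : (4 * l) ^ (2 * α) * (4 * l) ^ (ρ + α) = 4 ^ (3 * α + ρ) * l ^ (3 * α + ρ) := by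
    rw [← Real.rpow_add hl4, ← Real.mul_rpow (by norm_num) hl.le]
    congr 1
    ring
  -- The exponent `ρ` cancels, so the order obtained does not depend on `r`.
  have e2 : l⁻¹ * l⁻¹ ^ ρ * l ^ (3 * α + ρ) = l ^ (3 * α - 1) := by
    rw [Real.inv_rpow hl.le, ← Real.rpow_neg hl.le, ← Real.rpow_neg_one, ← Real.rpow_add hl,
      ← Real.rpow_add hl]
    congr 1
    ring
  calc _ = sewConst (ρ + α) * (C₁ + 2 * C₂) * (l⁻¹ * l⁻¹ ^ ρ)
        * ((4 * l) ^ (2 * α) * (4 * l) ^ (ρ + α)) := by ring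
    _ = sewConst (ρ + α) * (C₁ + 2 * C₂) * 4 ^ (3 * α + ρ)
        * (l⁻¹ * l⁻¹ ^ ρ * l ^ (3 * α + ρ)) := by rw [e1]; ring
    _ = _ := by rw [e2]

end RoughPath

/-! ### A smooth partition of unity by translates -/

/-- A smooth bump function supported in `[-1, 1]` whose integer translates sum to one. -/
noncomputable def unitBump (y : ℝ) : ℝ := Real.smoothTransition (y + 1) - Real.smoothTransition y

theorem contDiff_unitBump : ContDiff ℝ ∞ unitBump :=
  (Real.smoothTransition.contDiff.comp (contDiff_id.add contDiff_const)).sub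
    Real.smoothTransition.contDiff

theorem tsupport_unitBump_subset : tsupport unitBump ⊆ Metric.closedBall (0 : ℝ) 1 := by
  refine closure_minimal (fun y hy => ?_) Metric.isClosed_closedBall
  rw [mem_closedBall_zero_iff, Real.norm_eq_abs]
  by_contra hcon
  refine hy ?_
  rcases lt_abs.mp (not_le.mp hcon) with h | h
  · rw [unitBump, Real.smoothTransition.one_of_one_le h.le,
      Real.smoothTransition.one_of_one_le (by linarith), sub_self]
  · rw [unitBump, Real.smoothTransition.zero_of_nonpos (by linarith),
      Real.smoothTransition.zero_of_nonpos (by linarith), sub_self]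

theorem hasCompactSupport_unitBump : HasCompactSupport unitBump :=
  (isCompact_closedBall (0 : ℝ) 1).of_isClosed_subset (isClosed_tsupport _)
    tsupport_unitBump_subset

/-- The sum telescopes to the smooth step at `y + 1`, which is `1`, minus the one at `y - N`, which
is `0`. -/
theorem sum_unitBump {N : ℕ} {y : ℝ} (h0 : 0 ≤ y) (hN : y ≤ N) :
    ∑ i ∈ Finset.range (N + 1), unitBump (y - i) = 1 := by
  have h : ∀ i : ℕ, unitBump (y - i) = Real.smoothTransition (y - i + 1)
      - Real.smoothTransition (y - (i + 1 : ℕ) + 1) := by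
    intro i
    rw [unitBump]
    push_cast
    congr 2
    ring
  simp only [h]
  rw [Finset.sum_range_sub' fun i : ℕ => Real.smoothTransition (y - i + 1),
    Real.smoothTransition.one_of_one_le (by simpa using h0),
    Real.smoothTransition.zero_of_nonpos (by push_cast; linarith), sub_zero]

/-! ### Localized test functions -/

theorem exists_abs_iteratedDeriv_le {f : ℝ → ℝ} (hf : ContDiff ℝ ∞ f)
    (hc : HasCompactSupport f) (m : ℕ) : ∃ B : ℝ, 0 ≤ B ∧ ∀ t, |iteratedDeriv m f t| ≤ B := by
  obtain ⟨B, hB⟩ := (hf.continuous_iteratedFDeriv (m := m)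
    (by exact_mod_cast le_top)).bounded_above_of_compact_support (hc.iteratedFDeriv m)
  have h : ∀ t, |iteratedDeriv m f t| ≤ B := fun t => by
    rw [← Real.norm_eq_abs, ← norm_iteratedFDeriv_eq_norm_iteratedDeriv]
    exact hB t
  exact ⟨B, (abs_nonneg _).trans (h 0), h⟩

/-- The test function `z ↦ c ψ(x + l z) χ(z)`, where `χ` is the unit bump. -/
noncomputable def localize (ψ : TestFn) (c x l : ℝ) : TestFn where
  toFun z := c * (ψ (x + l * z) * unitBump z)
  contDiff' := by
    have h := ψ.contDiff
    have h' := contDiff_unitBump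
    fun_prop
  hasCompactSupport' :=
    (hasCompactSupport_unitBump.mul_left (f := fun z => ψ (x + l * z))).mul_left
      (f := fun _ => c)
  tsupport_subset' := fun _ _ => trivial

theorem localize_apply (ψ : TestFn) (c x l z : ℝ) :
    localize ψ c x l z = c * (ψ (x + l * z) * unitBump z) := rfl

theorem tsupport_localize_subset (ψ : TestFn) (c x l : ℝ) :
    tsupport (localize ψ c x l) ⊆ Metric.closedBall (0 : ℝ) 1 :=
  (tsupport_mul_subset_right (f := fun _ => c)).trans
    ((tsupport_mul_subset_right (f := fun z => ψ (x + l * z))).trans tsupport_unitBump_subset)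

theorem iteratedDeriv_comp_affine {f : ℝ → ℝ} (hf : ContDiff ℝ ∞ f) (m : ℕ) (x l z : ℝ) :
    iteratedDeriv m (fun z => f (x + l * z)) z = l ^ m * iteratedDeriv m f (x + l * z) := by
  have h1 : ContDiff ℝ m fun y => f (x + y) :=
    (hf.comp (contDiff_const.add contDiff_id)).of_le (by exact_mod_cast le_top)
  rw [iteratedDeriv_comp_const_mul h1 l, iteratedDeriv_comp_const_add]

/-- In Leibniz' rule each derivative of `z ↦ ψ (x + l * z)` brings a factor `l ≤ 1`, which makes the
bound uniform in `x` and `l`. -/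
theorem exists_abs_iteratedDeriv_localize_le (ψ : TestFn) (m : ℕ) :
    ∃ B : ℝ, 0 ≤ B ∧ ∀ c x l z : ℝ, 0 ≤ l → l ≤ 1 →
      |iteratedDeriv m (localize ψ c x l) z| ≤ |c| * B := by
  choose P hP0 hP using exists_abs_iteratedDeriv_le ψ.contDiff ψ.hasCompactSupport
  choose Q hQ0 hQ using exists_abs_iteratedDeriv_le contDiff_unitBump hasCompactSupport_unitBump
  refine ⟨∑ i ∈ Finset.range (m + 1), m.choose i * P i * Q (m - i),
    Finset.sum_nonneg fun i _ => mul_nonneg (mul_nonneg (by positivity) (hP0 i)) (hQ0 _),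
    fun c x l z hl0 hl1 => ?_⟩
  have hψ : ContDiff ℝ ∞ ψ := ψ.contDiff
  have h1 : ContDiff ℝ m fun z => ψ (x + l * z) :=
    (hψ.comp (contDiff_const.add (contDiff_const.mul contDiff_id))).of_le
      (by exact_mod_cast le_top)
  have h2 : ContDiff ℝ m unitBump := contDiff_unitBump.of_le (by exact_mod_cast le_top)
  have hfun : (localize ψ c x l : ℝ → ℝ) = fun z => c * (ψ (x + l * z) * unitBump z) := rfl
  rw [hfun, iteratedDeriv_const_mul_field, abs_mul]
  refine mul_le_mul_of_nonneg_left ?_ (abs_nonneg c)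
  rw [iteratedDeriv_fun_mul h1.contDiffAt h2.contDiffAt]
  refine (Finset.abs_sum_le_sum_abs _ _).trans (Finset.sum_le_sum fun i _ => ?_)
  rw [iteratedDeriv_comp_affine hψ, abs_mul, abs_mul, abs_mul, abs_pow, Nat.abs_cast,
    abs_of_nonneg hl0]
  have hl : l ^ i * |iteratedDeriv i ψ (x + l * z)| ≤ P i :=
    (mul_le_of_le_one_left (abs_nonneg _) (pow_le_one₀ hl0 hl1)).trans (hP i _)
  exact mul_le_mul (mul_le_mul_of_nonneg_left hl (by positivity)) (hQ _ z) (abs_nonneg _)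
    (mul_nonneg (by positivity) (hP0 i))

/-- For `|t - s| ≤ 1` the Hölder clause follows from the next derivative, whose order is at most
`⌈r⌉₊`. For `|t - s| ≥ 1` it follows from the two values, and here the bound `1 / 2` is needed. -/
theorem inBall_of_abs_iteratedDeriv_le {r : ℝ} {φ : TestFn}
    (hsupp : tsupport φ ⊆ Metric.closedBall (0 : ℝ) 1)
    (h : ∀ k ≤ ⌈r⌉₊, ∀ t, |iteratedDeriv k φ t| ≤ 1 / 2) : InBall r φ where
  support := hsupp
  bound k hk t := (h k (Nat.lt_ceil.mpr hk).le t).trans (by norm_num)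
  holder k hk hk1 s t := by
    have hlt : k < ⌈r⌉₊ := Nat.lt_ceil.mpr hk
    rcases le_total |t - s| 1 with hst | hst
    · have hd : Differentiable ℝ (iteratedDeriv k φ) :=
        φ.contDiff.differentiable_iteratedDeriv k (by exact_mod_cast WithTop.coe_lt_top k)
      have hb : ∀ x ∈ Set.univ, ‖deriv (iteratedDeriv k φ) x‖ ≤ 1 := fun x _ => by
        rw [← iteratedDeriv_succ]
        exact (h (k + 1) hlt x).trans (by norm_num)
      have h1 := Convex.norm_image_sub_le_of_norm_deriv_le (fun x _ => hd x) hb convex_univ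
        (Set.mem_univ s) (Set.mem_univ t)
      rw [one_mul, Real.norm_eq_abs, Real.norm_eq_abs] at h1
      refine h1.trans ?_
      rcases (abs_nonneg (t - s)).eq_or_lt with h0 | h0
      · rw [← h0]; positivity
      · simpa using Real.rpow_le_rpow_of_exponent_ge h0 hst (by linarith : r - k ≤ 1)
    · have h1 := h k hlt.le t
      have h2 := h k hlt.le s
      calc _ ≤ |iteratedDeriv k φ t| + |iteratedDeriv k φ s| := abs_sub _ _
        _ ≤ 1 := by linarith
        _ ≤ _ := Real.one_le_rpow hst (by linarith)

theorem exists_inBall_localize (r : ℝ) (ψ : TestFn) :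
    ∃ c : ℝ, 0 < c ∧ ∀ x l : ℝ, 0 ≤ l → l ≤ 1 → InBall r (localize ψ c x l) := by
  choose B hB0 hB using exists_abs_iteratedDeriv_localize_le ψ
  set S : ℝ := ∑ k ∈ Finset.range (⌈r⌉₊ + 1), B k with hS
  have hS0 : 0 ≤ S := Finset.sum_nonneg fun k _ => hB0 k
  refine ⟨(2 * (S + 1))⁻¹, by positivity, fun x l hl0 hl1 =>
    inBall_of_abs_iteratedDeriv_le (tsupport_localize_subset _ _ _ _) fun k hk t => ?_⟩
  have hle : B k ≤ S := Finset.single_le_sum (f := B) (fun i _ => hB0 i)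
    (Finset.mem_range.mpr (by omega))
  refine (hB k _ x l t hl0 hl1).trans ?_
  rw [abs_of_pos (by positivity), inv_mul_le_iff₀ (by positivity)]
  linarith

/-- A test function supported in `[-M, M]` is a sum of localized test functions at scale `1 / p`. -/
theorem eq_sum_rescale_localize (ψ : TestFn) {M p : ℕ} (hp : 0 < p)
    (hsupp : tsupport ψ ⊆ Set.Icc (-M : ℝ) M) {c : ℝ} (hc : 0 < c)
    (hl : 0 < (1 / p : ℝ)) :
    ψ = ∑ i ∈ Finset.range (2 * M * p + 1), ((1 / p : ℝ) * c⁻¹) •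
      rescale (localize ψ c (-M + i * (1 / p)) (1 / p)) (-M + i * (1 / p)) (1 / p) hl := by
  have hp' : (p : ℝ) ≠ 0 := by positivity
  ext y
  have hcoe : ∀ (s : Finset ℕ) (F : ℕ → TestFn), (∑ i ∈ s, F i) y = ∑ i ∈ s, F i y := by
    intro s F
    classical
    induction s using Finset.induction_on with
    | empty => rfl
    | insert i s hi ih =>
      rw [Finset.sum_insert hi, Finset.sum_insert hi, ← ih]
      rfl
  have hterm : ∀ i : ℕ, (((1 / p : ℝ) * c⁻¹) •
      rescale (localize ψ c (-M + i * (1 / p)) (1 / p)) (-M + i * (1 / p)) (1 / p) hl) y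
      = ψ y * unitBump (p * (y + M) - i) := by
    intro i
    change ((1 / p : ℝ) * c⁻¹) *
      rescale (localize ψ c (-M + i * (1 / p)) (1 / p)) (-M + i * (1 / p)) (1 / p) hl y = _
    rw [rescale_apply, localize_apply]
    -- Rescaling at the same centre and scale undoes the zoom of `localize`. What remains is `ψ`
    -- times a bump around the grid point `-M + i / p`.
    have e1 : -(M : ℝ) + i * (1 / p) + 1 / p * ((1 / p : ℝ)⁻¹ * (y - (-M + i * (1 / p)))) = y := by
      field_simp
      ring
    have e2 : (1 / p : ℝ)⁻¹ * (y - (-M + i * (1 / p))) = p * (y + M) - i := by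
      field_simp
      ring
    rw [e1, e2]
    field_simp
  rw [hcoe, Finset.sum_congr rfl fun i _ => hterm i, ← Finset.mul_sum]
  by_cases hy : y ∈ Set.Icc (-M : ℝ) M
  · rw [sum_unitBump, mul_one]
    · exact mul_nonneg (by positivity) (by linarith [hy.1])
    · push_cast
      have := mul_le_mul_of_nonneg_left (by linarith [hy.2] : y + M ≤ 2 * M)
        (by positivity : (0 : ℝ) ≤ p)
      linarith
  · rw [image_eq_zero_of_notMem_tsupport fun h => hy (hsupp h), zero_mul]

/-! ### Uniqueness of the reconstruction -/

/-- A distribution that is small of positive order on rescaled test functions vanishes. -/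
theorem eq_zero_of_abs_rescale_le {ξ : Distr} {r γ : ℝ} (hγ : 0 < γ)
    (h : ∀ K : Set ℝ, IsCompact K → ∃ C : ℝ, ∀ x ∈ K, ∀ φ : TestFn, InBall r φ →
      ∀ (l : ℝ) (hl : 0 < l), l ≤ 1 → |ξ (rescale φ x l hl)| ≤ C * l ^ γ) : ξ = 0 := by
  ext ψ
  change ξ ψ = 0
  obtain ⟨B, hB⟩ := ψ.hasCompactSupport.isCompact.isBounded.subset_closedBall 0
  obtain ⟨M, hM⟩ := exists_nat_ge B
  have hsupp : tsupport ψ ⊆ Set.Icc (-M : ℝ) M := fun s hs => by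
    have := hB hs
    rw [mem_closedBall_zero_iff, Real.norm_eq_abs] at this
    exact abs_le.mp (this.trans hM)
  obtain ⟨C, hC⟩ := h (Set.Icc (-M : ℝ) M) isCompact_Icc
  obtain ⟨c, hc, hball⟩ := exists_inBall_localize r ψ
  -- At scale `1 / p` there are `2 * M * p + 1` pieces of weight `c⁻¹ / p`, each tested at size `|C|
  -- * (1 / p) ^ γ`; the total weight stays bounded as `p` grows.
  have hbound : ∀ p : ℕ, 0 < p →
      |ξ ψ| ≤ (2 * M + 1) * c⁻¹ * |C| * (1 / p : ℝ) ^ γ := by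
    intro p hp
    have hp1 : (1 : ℝ) ≤ p := by exact_mod_cast hp
    have hl : 0 < (1 / p : ℝ) := by positivity
    have hl1 : (1 / p : ℝ) ≤ 1 := by rw [div_le_one (by positivity)]; exact hp1
    have hterm : ∀ i ∈ Finset.range (2 * M * p + 1), |((1 / p : ℝ) * c⁻¹) *
        ξ (rescale (localize ψ c (-M + i * (1 / p)) (1 / p)) (-M + i * (1 / p)) (1 / p) hl)|
        ≤ (1 / p : ℝ) * c⁻¹ * (|C| * (1 / p : ℝ) ^ γ) := by
      intro i hi
      rw [abs_mul, abs_of_pos (by positivity : 0 < (1 / p : ℝ) * c⁻¹)]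
      refine mul_le_mul_of_nonneg_left ?_ (by positivity)
      have hi' : (i : ℝ) ≤ 2 * M * p := by
        have := Finset.mem_range.mp hi
        exact_mod_cast (by omega : i ≤ 2 * M * p)
      have hx : -(M : ℝ) + i * (1 / p) ∈ Set.Icc (-M : ℝ) M := by
        refine ⟨by linarith [(by positivity : (0 : ℝ) ≤ i * (1 / p))], ?_⟩
        have : (i : ℝ) * (1 / p) ≤ 2 * M := by
          rw [mul_one_div, div_le_iff₀ (by positivity)]
          exact hi'
        linarith
      refine (hC _ hx _ (hball _ _ hl.le hl1) _ hl hl1).trans ?_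
      exact mul_le_mul_of_nonneg_right (le_abs_self C) (by positivity)
    have hψ := congrArg ξ (eq_sum_rescale_localize ψ hp hsupp hc hl)
    simp only [map_sum, map_smul, smul_eq_mul] at hψ
    rw [hψ]
    refine (Finset.abs_sum_le_sum_abs _ _).trans ((Finset.sum_le_sum hterm).trans ?_)
    rw [Finset.sum_const, Finset.card_range, nsmul_eq_mul]
    push_cast
    have e : (2 * (M : ℝ) * p + 1) * (1 / p) ≤ 2 * M + 1 := by
      rw [mul_one_div, div_le_iff₀ (by positivity)]
      linarith
    calc _ = (2 * (M : ℝ) * p + 1) * (1 / p) * (c⁻¹ * |C| * (1 / p : ℝ) ^ γ) := by ring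
      _ ≤ (2 * M + 1) * (c⁻¹ * |C| * (1 / p : ℝ) ^ γ) :=
        mul_le_mul_of_nonneg_right e (by positivity)
      _ = _ := by ring
  have hlim : Tendsto (fun p : ℕ => (2 * M + 1) * c⁻¹ * |C| * (1 / p : ℝ) ^ γ) atTop (𝓝 0) := by
    have h1 := (tendsto_one_div_atTop_nhds_zero_nat (𝕜 := ℝ)).rpow_const (p := γ) (Or.inr hγ.le)
    rw [Real.zero_rpow hγ.ne'] at h1
    simpa using h1.const_mul ((2 * M + 1) * c⁻¹ * |C|)
  exact abs_nonpos_iff.mp (ge_of_tendsto hlim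
    ((eventually_gt_atTop 0).mono fun p hp => hbound p hp))

theorem RoughPath.IsReconstruction.unique {α : ℝ} {n : ℕ} {R : RoughPath α n} {r γ : ℝ}
    {f : ℝ → ModelSpace n} {η η' : Distr} (hγ : 0 < γ) (h : R.IsReconstruction r γ f η)
    (h' : R.IsReconstruction r γ f η') : η' = η := by
  rw [← sub_eq_zero]
  refine eq_zero_of_abs_rescale_le (r := r) hγ fun K hK => ?_
  obtain ⟨C, hC⟩ := h K hK
  obtain ⟨C', hC'⟩ := h' K hK
  refine ⟨C' + C, fun x hx φ hφ l hl hl1 => ?_⟩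
  have h1 := hC x hx φ hφ l hl hl1
  have h2 := hC' x hx φ hφ l hl hl1
  have e : (η' - η) (rescale φ x l hl) = (η' - R.PiMap x (f x)) (rescale φ x l hl)
      - (η - R.PiMap x (f x)) (rescale φ x l hl) := by
    have : η' - η = (η' - R.PiMap x (f x)) - (η - R.PiMap x (f x)) := by abel
    rw [this]
    rfl
  rw [e, add_mul]
  exact (abs_sub _ _).trans (add_le_add h2 h1)

end ControlledRP

theorem lemma3p2 {α : ℝ} (hα : α ∈ Set.Ioo (1 / 3 : ℝ) (1 / 2)) {n : ℕ} (R : RoughPath α n)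
    (Y : ℝ → ℝ) (Y' : ℝ → Fin n → ℝ) (hY : R.IsControlled Y Y') (j : Fin n) :
    mulXi Y Y' j ∈ R.modelled (3 * α - 1) ∧
    ∃ η : Distr,
      -- `η` is the reconstruction of `Ŷ Ξ_j`, for every `r > |inf A| = 1 - α`
      (∀ r : ℝ, 1 - α < r →
        R.IsReconstruction r (3 * α - 1) (mulXi Y Y' j) η ∧
        ∀ η' : Distr, R.IsReconstruction r (3 * α - 1) (mulXi Y Y' j) η' → η' = η) ∧
      ∃ Z : ℝ → ℝ,
        (∀ ψ : TestFn, HasStieltjesIntegral ψ Z (η ψ)) ∧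
        (∀ K : Set ℝ, IsCompact K → ∃ C : ℝ, ∀ s ∈ K, ∀ t ∈ K,
          |Z t - Z s - (Y s * (R.X t j - R.X s j) + ∑ i, Y' s i * R.XX s t i j)|
            ≤ C * |t - s| ^ (3 * α)) ∧
        R.IsRoughIntegral Y Y' j Z := by
  have hα3 : 1 / 3 < α := hα.1
  have hα0 : 0 < α := by linarith
  obtain ⟨Z, hZ, hint⟩ := R.exists_rough_integral hα3 hY j
  -- Continuity of `Z` comes from its local expansion; it makes `stieltjes Z` a genuine
  -- Riemann-Stieltjes integral.
  have hZc : Continuous Z := by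
    refine continuous_of_increments
      (G := fun s t => (Z t - Z s - R.germ Y Y' j s t) + R.germ Y Y' j s t) (fun s => ?_)
      fun s t => by ring
    have h := (tendsto_zero_of_local_bound
      (F := fun s t => Z t - Z s - R.germ Y Y' j s t) (by linarith : 0 < 3 * α) hZ s).add
      (R.tendsto_germ (Y := Y) (Y' := Y') hα0 j s)
    rw [add_zero] at h
    exact h
  -- The distribution `dZ` is fixed before `r`, hence independent of it. Uniqueness uses `3 * α - 1
  -- > 0`.
  refine ⟨R.mulXi_mem_modelled hα3 hY j, stieltjes Z, fun r hr => ?_, Z,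
    hasStieltjesIntegral_stieltjes hZc, hZ, hint⟩
  have hrec := R.isReconstruction_stieltjes hα3 hY j hZ hZc (by linarith [hα.2]) hr
  exact ⟨hrec, fun η' hη' => hrec.unique (by linarith) hη'⟩
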